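/- **Setup.** Let $(\Gamma,d)$ be an infinite discrete metric space of polynomial growth: there are constants $C,D>0$ with $|B_r(X)|\le C|X|(1+r)^D$ for all finite $X\subset\Gamma$ and all $r\ge 0$, where $B_r(X)=\{y\in\Gamma: d(y,X)<r\}$. For every $x\in\Gamma$ let an integer $d_x\ge 1$ be given. For finite $X\subset\Gamma$ put $\mathcal A_X=\bigotimes_{x\in X}M_{d_x}(\mathbb C)$, let $\mathcal A_{\mathrm{loc}}=\varinjlim_X\mathcal A_X$, and let $\mathcal A$ be the $C^*$-algebra obtained as the norm completion of $\mathcal A_{\mathrm{loc}}$. An interaction $\Phi$ assigns to every finite $X\subset\Gamma$ a self-adjoint element $\Phi(X)\in\mathcal A_X$. Assume that for some constants $\mu,v>0$ and all $x\in\Gamma$ $$\sum_{Z\ni x}\|\Phi(Z)\|\,|Z|\,e^{\mu\,\mathrm{diam}(Z)}\le v/2 ,$$ the sum being over the finite $Z\subset\Gamma$ that contain $x$. Let $\tau=(\tau_t)_{t\in\mathbb R}$ be the time evolution determined by $\Phi$: the strongly continuous one-parameter group of $*$-automorphisms of $\mathcal A$ such that, for every $A\in\mathcal A_{\mathrm{loc}}$,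 the function $t\mapsto\tau_t(A)$ has at $t=0$ the derivative $\delta(A)=\lim_{\Lambda}\, i\sum_{X\subset\Lambda}[\Phi(X),A]$, the limit being along the finite subsets $\Lambda$ of $\Gamma$ ordered by inclusion. Let $0\le\beta<\infty$ and let $\phi$ be a $\beta$-KMS state: a positive linear functional of norm $1$ on $\mathcal A$ such that for all $A,B\in\mathcal A_{\mathrm{loc}}$ there is a function $F_{A,B}$ that is bounded and continuous on the strip $\{0\le\operatorname{Im}z\le\beta\}$, holomorphic in its interior, and satisfies $F_{A,B}(t)=\phi(A\tau_t(B))$ and $F_{A,B}(t+i\beta)=\phi(\tau_t(B)A)$ for all $t\in\mathbb R$. The ordinary correlators and Kubo's canonical correlators are $$\langle A,B\rangle_\phi=\phi(AB)-\phi(A)\phi(B),\qquad \langle\langle A,B\rangle\rangle_\phi=\frac1\beta\int_0^\beta F_{A,B}(ib)\,db-\phi(A)\phi(B),$$ where for $\beta=0$ the average $\frac1\beta\int_0^\beta F_{A,B}(ib)\,db$ is read as $F_{A,B}(0)=\phi(AB)$. For finite $X,Y\subset\Gamma$ write $d(X,Y)=\min\{d(x,y):x\in X,\ y\in Y\}$.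 For a function $g:(0,\infty)\to[0,\infty)$ we say that *the ordinary correlators decay at rate $g$* if there is a constant $c$ such that for all finite $X,Y\subset\Gamma$ with $l=d(X,Y)>0$ and all $A\in\mathcal A_X$, $B\in\mathcal A_Y$ $$|\langle A,B\rangle_\phi|\le c\,\|A\|\,\|B\|\min\{|X|,|Y|\}\,g(l),$$ and that *the canonical correlators decay at rate $g'$* if there is a constant $c'$ such that for all such $X,Y,A,B$ $$|\langle\langle A,B\rangle\rangle_\phi|\le c'\,\|A\|\,\|B\|\min\{|X|^2,|Y|^2\}\,g'(l).$$ **Theorem.** 1. If $g:(0,\infty)\to[0,\infty)$ is monotone decreasing (not necessarily strictly) and the ordinary correlators decay at rate $g$, then the canonical correlators decay at rate $g'(l)=\max\{g(l/4),\,e^{-\mu l/2}\}$. 2. For every real $n>0$: if the ordinary correlators decay at rate $l^{-n}$, then the canonical correlators decay at rate $l^{-n}$. 3. For every $\xi>0$: if the ordinary correlators decay at rate $e^{-l/\xi}$, then there is a constant $\xi'>0$ (independent of $X,Y,A,B$ and $l$) such that the canonical correlators decay at rate $e^{-l/\xi'}$. -/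

import Mathlib

open Filter Topology

noncomputable section

namespace QuantumSpin

universe u

/-! ### The spin system and its algebra of observables -/

section Algebra

variable {Γ : Type u} (d : Γ → ℕ)

/-- A classical configuration: a choice of a basis vector of `ℂ ^ (d x)` at every site `x`. -/
abbrev Config : Type u := ∀ x : Γ, Fin (d x)

/-- A configuration on the finite region `X`. It labels the standard product basis of
`⨂ x ∈ X, ℂ ^ (d x)`. -/
abbrev LocalConfig (X : Finset Γ) : Type u := ∀ x : X, Fin (d x)

/-- The algebra `⨂ x ∈ X, M_{d x}`, as the algebra of matrices in the product basis. -/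
abbrev RegionMatrix (X : Finset Γ) : Type u := Matrix (LocalConfig d X) (LocalConfig d X) ℂ

/-- The Hilbert space `ℓ²` over all configurations, on which all local observables act. -/
abbrev ConfigSpace : Type u := lp (fun _ : Config d => ℂ) 2

instance (X : Finset Γ) : Fintype (LocalConfig d X) := by classical infer_instance

instance (X : Finset Γ) : DecidableEq (LocalConfig d X) := Classical.decEq _

variable {d}

/-- The restriction of a configuration to `X`. -/
def restrictTo (X : Finset Γ) (σ : Config d) : LocalConfig d X := fun x => σ x

open Classical in
/-- The configuration that is `η` on `X` and `σ` outside `X`. -/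
def replaceOn (X : Finset Γ) (σ : Config d) (η : LocalConfig d X) : Config d :=
  fun x => if h : x ∈ X then η ⟨x, h⟩ else σ x

@[simp] lemma restrictTo_replaceOn (X : Finset Γ) (σ : Config d) (η : LocalConfig d X) :
    restrictTo X (replaceOn X σ η) = η := by
  funext x
  simp [restrictTo, replaceOn]

@[simp] lemma replaceOn_replaceOn (X : Finset Γ) (σ : Config d) (η ζ : LocalConfig d X) :
    replaceOn X (replaceOn X σ η) ζ = replaceOn X σ ζ := by
  funext x
  by_cases h : x ∈ X <;> simp [replaceOn, h]

@[simp] lemma replaceOn_restrictTo (X : Finset Γ) (σ : Config d) :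
    replaceOn X σ (restrictTo X σ) = σ := by
  funext x
  by_cases h : x ∈ X <;> simp [replaceOn, restrictTo, h]

open Classical in
/-- Exchanging the values `ρ` and `η` on `X`. -/
def swapFun (X : Finset Γ) (ρ η : LocalConfig d X) (σ : Config d) : Config d :=
  if restrictTo X σ = ρ then replaceOn X σ η
  else if restrictTo X σ = η then replaceOn X σ ρ else σ

lemma swapFun_involutive (X : Finset Γ) (ρ η : LocalConfig d X) :
    Function.Involutive (swapFun X ρ η) := by
  intro σ
  by_cases h1 : restrictTo X σ = ρ
  · subst h1
    by_cases h : η = restrictTo X σ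
    · simp [swapFun, h]
    · simp [swapFun, h]
  · by_cases h2 : restrictTo X σ = η
    · subst h2
      simp [swapFun, h1]
    · simp [swapFun, h1, h2]

lemma summable_sq (ψ : ConfigSpace d) : Summable fun σ => ‖ψ σ‖ ^ 2 := by
  have := (lp.memℓp ψ).summable (by norm_num)
  simpa using this

lemma norm_sq_eq (ψ : ConfigSpace d) : ‖ψ‖ ^ 2 = ∑' σ, ‖ψ σ‖ ^ 2 := by
  have := lp.norm_rpow_eq_tsum (p := 2) (by norm_num) ψ
  simpa using this

open Classical in
/-- The coordinates of a matrix unit applied to a vector. -/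
def unitFun (X : Finset Γ) (ρ η : LocalConfig d X) (ψ : Config d → ℂ) (σ : Config d) : ℂ :=
  if restrictTo X σ = ρ then ψ (replaceOn X σ η) else 0

lemma norm_unitFun_le (X : Finset Γ) (ρ η : LocalConfig d X) (ψ : Config d → ℂ)
    (σ : Config d) : ‖unitFun X ρ η ψ σ‖ ^ 2 ≤ ‖ψ (swapFun X ρ η σ)‖ ^ 2 := by
  by_cases h : restrictTo X σ = ρ
  · simp [unitFun, swapFun, h]
  · have h0 : unitFun X ρ η ψ σ = 0 := by simp [unitFun, h]
    rw [h0, norm_zero, zero_pow two_ne_zero]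
    exact sq_nonneg _

lemma summable_swap (X : Finset Γ) (ρ η : LocalConfig d X) (ψ : ConfigSpace d) :
    Summable fun σ => ‖ψ (swapFun X ρ η σ)‖ ^ 2 :=
  ((swapFun_involutive X ρ η).toPerm.summable_iff (f := fun σ => ‖ψ σ‖ ^ 2)).2 (summable_sq ψ)

lemma summable_unitFun (X : Finset Γ) (ρ η : LocalConfig d X) (ψ : ConfigSpace d) :
    Summable fun σ => ‖unitFun X ρ η ψ σ‖ ^ 2 :=
  (summable_swap X ρ η ψ).of_nonneg_of_le (fun _ => by positivity) (norm_unitFun_le X ρ η ψ)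

/-- The matrix unit `|ρ⟩⟨η| ⊗ 1` of the region `X`, acting on the configuration space. -/
def matrixUnit (X : Finset Γ) (ρ η : LocalConfig d X) : ConfigSpace d →L[ℂ] ConfigSpace d :=
  LinearMap.mkContinuous
    { toFun := fun ψ => ⟨unitFun X ρ η ψ, memℓp_gen (by simpa using summable_unitFun X ρ η ψ)⟩
      map_add' := fun ψ χ => by
        ext σ
        change unitFun X ρ η _ σ = unitFun X ρ η ψ σ + unitFun X ρ η χ σ
        by_cases h : restrictTo X σ = ρ <;> simp [unitFun, h]
      map_smul' := fun c ψ => by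
        ext σ
        change unitFun X ρ η _ σ = c • unitFun X ρ η ψ σ
        by_cases h : restrictTo X σ = ρ <;> simp [unitFun, h] }
    1 (fun ψ => by
      rw [one_mul]
      refine le_of_sq_le_sq ?_ (norm_nonneg _)
      rw [norm_sq_eq, norm_sq_eq]
      calc _ ≤ ∑' σ, ‖ψ (swapFun X ρ η σ)‖ ^ 2 :=
            (summable_unitFun X ρ η ψ).tsum_le_tsum (norm_unitFun_le X ρ η ψ)
              (summable_swap X ρ η ψ)
        _ = _ := (swapFun_involutive X ρ η).toPerm.tsum_eq (fun σ => ‖ψ σ‖ ^ 2))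

lemma matrixUnit_apply (X : Finset Γ) (ρ η : LocalConfig d X) (ψ : ConfigSpace d)
    (σ : Config d) : matrixUnit X ρ η ψ σ = unitFun X ρ η ψ σ := rfl

lemma star_matrixUnit (X : Finset Γ) (ρ η : LocalConfig d X) :
    star (matrixUnit X ρ η) = matrixUnit X η ρ := by
  rw [ContinuousLinearMap.star_eq_adjoint, eq_comm, ContinuousLinearMap.eq_adjoint_iff]
  intro ψ χ
  rw [lp.inner_eq_tsum, lp.inner_eq_tsum]
  rw [← (swapFun_involutive X ρ η).toPerm.tsum_eq]
  refine tsum_congr fun σ => ?_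
  simp only [matrixUnit_apply, Function.Involutive.coe_toPerm]
  by_cases h1 : restrictTo X σ = ρ
  · subst h1
    simp [swapFun, unitFun]
  · by_cases h2 : restrictTo X σ = η
    · subst h2
      have h3 : ρ ≠ restrictTo X σ := fun h => h1 h.symm
      simp [swapFun, unitFun, h1, h3]
    · simp [swapFun, unitFun, h1, h2]

lemma sum_matrixUnit (X : Finset Γ) :
    ∑ ρ : LocalConfig d X, matrixUnit X ρ ρ = (1 : ConfigSpace d →L[ℂ] ConfigSpace d) := by
  ext ψ σ
  simp only [sum_apply, lp.coeFn_sum, Finset.sum_apply]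
  rw [Finset.sum_eq_single (restrictTo X σ)]
  · simp [matrixUnit_apply, unitFun]
  · intro ρ _ h
    simp [matrixUnit_apply, unitFun, h.symm]
  · simp

/-- The operator `M ⊗ 1` on the configuration space, for a matrix `M` of the region `X`. -/
def regionOperator (X : Finset Γ) (M : RegionMatrix d X) : ConfigSpace d →L[ℂ] ConfigSpace d :=
  ∑ ρ, ∑ η, M ρ η • matrixUnit X ρ η

lemma regionOperator_apply (X : Finset Γ) (M : RegionMatrix d X) (ψ : ConfigSpace d)
    (σ : Config d) :
    regionOperator X M ψ σ = ∑ η, M (restrictTo X σ) η * ψ (replaceOn X σ η) := by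
  simp only [regionOperator, sum_apply, lp.coeFn_sum, Finset.sum_apply]
  rw [Finset.sum_eq_single (restrictTo X σ)]
  · simp [matrixUnit_apply, unitFun]
  · intro ρ _ h
    simp [matrixUnit_apply, unitFun, h.symm]
  · simp

/-- The action `M ↦ M ⊗ 1` of the matrices of the region `X` on the configuration space, a unital
`*`-homomorphism. -/
def regionAction (X : Finset Γ) :
    RegionMatrix d X →⋆ₐ[ℂ] (ConfigSpace d →L[ℂ] ConfigSpace d) where
  toFun := regionOperator X
  map_one' := by
    rw [← sum_matrixUnit X]
    refine Finset.sum_congr rfl fun ρ _ => ?_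
    simp [Matrix.one_apply]
  map_mul' M N := by
    ext ψ σ
    simp only [mul_apply_eq_comp, regionOperator_apply, restrictTo_replaceOn,
      replaceOn_replaceOn, Matrix.mul_apply, Finset.sum_mul, Finset.mul_sum, mul_assoc]
    exact Finset.sum_comm
  map_zero' := by simp [regionOperator]
  map_add' M N := by simp [regionOperator, add_smul, Finset.sum_add_distrib]
  commutes' c := by
    rw [Algebra.algebraMap_eq_smul_one, Algebra.algebraMap_eq_smul_one, ← sum_matrixUnit X,
      Finset.smul_sum]
    refine Finset.sum_congr rfl fun ρ _ => ?_
    simp [Matrix.one_apply]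
  map_star' M := by
    simp only [regionOperator, star_sum, star_smul, star_matrixUnit]
    rw [Finset.sum_comm]
    rfl

/-- Distinct matrices of the region `X` act differently, so `regionAction X` is an isometric
isomorphism of the `C*`-algebra of these matrices onto its range. -/
lemma regionAction_injective [∀ x, NeZero (d x)] (X : Finset Γ) :
    Function.Injective (regionAction (d := d) X) := by
  classical
  intro M N h
  ext ρ η
  let σ : Config d := replaceOn X (fun _ => 0) ρ
  let ψ : ConfigSpace d := lp.single 2 (replaceOn X (fun _ => 0) η) (1 : ℂ)
  have key : ∀ K : RegionMatrix d X, regionOperator X K ψ σ = K ρ η := by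
    intro K
    rw [regionOperator_apply, Finset.sum_eq_single η]
    · simp [σ, ψ]
    · intro ζ _ hζ
      have : replaceOn X σ ζ ≠ replaceOn X (fun _ => 0) η := by
        intro e
        have := congrArg (restrictTo X) e
        simp only [restrictTo_replaceOn] at this
        exact hζ this
      simp [ψ, lp.single_apply, this]
    · simp
  rw [← key M, ← key N]
  exact congrArg (fun T : ConfigSpace d →L[ℂ] ConfigSpace d => T ψ σ) h

variable (d) in
/-- The `C*`-algebra of quasi-local observables: the norm closure of the union of the (directed)
family of the algebras `⨂ x ∈ X, M_{d x}`, `X ⊆ Γ` finite. -/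
def quasiLocalAlgebra : StarSubalgebra ℂ (ConfigSpace d →L[ℂ] ConfigSpace d) :=
  (⨆ X : Finset Γ, (regionAction (d := d) X).range).topologicalClosure

variable (d) in
/-- The quasi-local observables. -/
abbrev Observable : Type u := quasiLocalAlgebra d

instance : CompleteSpace (Observable d) :=
  (StarSubalgebra.isClosed_topologicalClosure
    (⨆ X : Finset Γ, (regionAction (d := d) X).range)).completeSpace_coe

/-- The algebra `𝒜_X` of the observables supported in the finite region `X`. -/
def localAlgebra (X : Finset Γ) : StarSubalgebra ℂ (Observable d) :=
  (regionAction (d := d) X).range.comap (quasiLocalAlgebra d).subtype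

/-- The observable `A` is local, that is, `A ∈ 𝒜_loc`. -/
def IsLocal (A : Observable d) : Prop := ∃ X : Finset Γ, A ∈ localAlgebra X

end Algebra

/-! ### Interactions and time evolution -/

section Dynamics

variable {Γ : Type u}

/-- An interaction: a self-adjoint element `Φ X` of `𝒜_X` for every finite `X ⊆ Γ`. -/
structure Interaction (d : Γ → ℕ) where
  toFun : Finset Γ → Observable d
  isSelfAdjoint : ∀ X, IsSelfAdjoint (toFun X)
  mem_localAlgebra : ∀ X, toFun X ∈ localAlgebra X

variable {d : Γ → ℕ}

/-- The exponential short-range condition: for every site `x`,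
`∑_{Z ∋ x} ‖Φ Z‖ |Z| exp (μ diam Z) ≤ v / 2`. -/
def Interaction.IsShortRange [MetricSpace Γ] (Φ : Interaction d) (μ v : ℝ) : Prop :=
  ∀ x : Γ,
    Summable (fun Z : {Z : Finset Γ // x ∈ Z} =>
      ‖Φ.toFun Z‖ * (Z.1.card : ℝ) * Real.exp (μ * Metric.diam (Z.1 : Set Γ))) ∧
    ∑' Z : {Z : Finset Γ // x ∈ Z},
      ‖Φ.toFun Z‖ * (Z.1.card : ℝ) * Real.exp (μ * Metric.diam (Z.1 : Set Γ)) ≤ v / 2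

/-- The derivation of a finite volume `Λ`: `δ_Λ(A) = i ∑_{X ⊆ Λ} [Φ X, A]`. -/
def Interaction.localDerivation (Φ : Interaction d) (Λ : Finset Γ) (A : Observable d) :
    Observable d :=
  Complex.I • ∑ X ∈ Λ.powerset, (Φ.toFun X * A - A * Φ.toFun X)

/-- `τ` is the time evolution determined by `Φ`: a strongly continuous one-parameter group of
`*`-automorphisms of the quasi-local algebra such that, for every local `A`, the function
`t ↦ τ_t(A)` has at `t = 0` the derivative `δ(A) = lim_Λ i ∑_{X ⊆ Λ} [Φ X, A]`, the limit along the
finite subsets `Λ` of `Γ` ordered by inclusion. -/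
structure IsTimeEvolution (Φ : Interaction d)
    (τ : ℝ → (Observable d ≃⋆ₐ[ℂ] Observable d)) : Prop where
  map_zero : ∀ A, τ 0 A = A
  map_add : ∀ s t A, τ (s + t) A = τ s (τ t A)
  continuous : ∀ A, Continuous fun t => τ t A
  hasDerivAt : ∀ A, IsLocal A → ∃ δA : Observable d,
    Tendsto (fun Λ : Finset Γ => Φ.localDerivation Λ A) atTop (𝓝 δA) ∧
      HasDerivAt (fun t => τ t A) δA 0

end Dynamics

/-! ### KMS states and correlators -/

section States

variable {Γ : Type u} {d : Γ → ℕ}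

/-- A state: a positive linear functional of norm one. -/
structure IsState (φ : Observable d →L[ℂ] ℂ) : Prop where
  re_nonneg : ∀ A, 0 ≤ (φ (star A * A)).re
  im_eq_zero : ∀ A, (φ (star A * A)).im = 0
  norm_eq_one : ‖φ‖ = 1

/-- `F` is a function `F_{A,B}` as in the KMS condition: it is bounded and continuous on the closed
strip `0 ≤ Im z ≤ β`, holomorphic in its interior, and has the boundary values
`F(t) = φ(A τ_t(B))` and `F(t + iβ) = φ(τ_t(B) A)`. On the strip it is determined by these
conditions. -/
structure IsKMSFunction (β : ℝ) (τ : ℝ → (Observable d ≃⋆ₐ[ℂ] Observable d))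
    (φ : Observable d →L[ℂ] ℂ) (A B : Observable d) (F : ℂ → ℂ) : Prop where
  continuousOn : ContinuousOn F {z | 0 ≤ z.im ∧ z.im ≤ β}
  differentiableOn : DifferentiableOn ℂ F {z | 0 < z.im ∧ z.im < β}
  bounded : ∃ M : ℝ, ∀ z : ℂ, 0 ≤ z.im → z.im ≤ β → ‖F z‖ ≤ M
  lower : ∀ t : ℝ, F t = φ (A * τ t B)
  upper : ∀ t : ℝ, F (t + Complex.I * β) = φ (τ t B * A)

/-- `φ` is a `β`-KMS state for the time evolution `τ`. -/
structure IsKMSState (β : ℝ) (τ : ℝ → (Observable d ≃⋆ₐ[ℂ] Observable d))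
    (φ : Observable d →L[ℂ] ℂ) : Prop extends IsState φ where
  exists_kmsFunction : ∀ A B, IsLocal A → IsLocal B → ∃ F, IsKMSFunction β τ φ A B F

open Classical in
/-- The function `F_{A,B}` of the KMS condition (zero if there is none, which does not happen for
local `A`, `B` in a `β`-KMS state). -/
def kmsFunction (β : ℝ) (τ : ℝ → (Observable d ≃⋆ₐ[ℂ] Observable d))
    (φ : Observable d →L[ℂ] ℂ) (A B : Observable d) : ℂ → ℂ :=
  if h : ∃ F, IsKMSFunction β τ φ A B F then h.choose else 0

/-- The ordinary correlator `⟨A, B⟩_φ`. -/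
def correlator (φ : Observable d →L[ℂ] ℂ) (A B : Observable d) : ℂ :=
  φ (A * B) - φ A * φ B

/-- Kubo's canonical correlator `⟨⟨A, B⟩⟩_φ`. For `β = 0` the average of `F_{A,B}(ib)` over
`b ∈ [0, β]` is read as its value at `b = 0`. -/
def canonicalCorrelator (β : ℝ) (τ : ℝ → (Observable d ≃⋆ₐ[ℂ] Observable d))
    (φ : Observable d →L[ℂ] ℂ) (A B : Observable d) : ℂ :=
  (if β = 0 then kmsFunction β τ φ A B 0
    else (1 / (β : ℂ)) * ∫ b in (0 : ℝ)..β, kmsFunction β τ φ A B (Complex.I * b)) - φ A * φ B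

end States

/-! ### Geometry and decay -/

section Decay

variable {Γ : Type u} [MetricSpace Γ]

variable (Γ) in
/-- Polynomial growth: there are constants `C, D > 0` such that
`|{y | d(y, X) < r}| ≤ C |X| (1 + r) ^ D` for all finite `X ⊆ Γ` and `r ≥ 0`. -/
def HasPolynomialGrowth : Prop :=
  ∃ C > (0 : ℝ), ∃ D > (0 : ℝ), ∀ (X : Finset Γ) (r : ℝ), 0 ≤ r →
    (Metric.thickening r (X : Set Γ)).Finite ∧
      ((Metric.thickening r (X : Set Γ)).ncard : ℝ) ≤ C * X.card * (1 + r) ^ D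

/-- The distance `d(X, Y) = min {d(x, y) | x ∈ X, y ∈ Y}` of two finite sets (zero if one of them
is empty). -/
def setDist (X Y : Finset Γ) : ℝ := ⨅ p : X × Y, dist (p.1 : Γ) (p.2 : Γ)

variable {d : Γ → ℕ}

/-- For some constant `c`, all finite `X`, `Y` with `l = d(X, Y) > 0` and all `A ∈ 𝒜_X`, `B ∈ 𝒜_Y`:
`|⟨A, B⟩_φ| ≤ c ‖A‖ ‖B‖ min (|X|, |Y|) g(l)`. -/
def CorrelatorsDecay (φ : Observable d →L[ℂ] ℂ) (g : ℝ → ℝ) : Prop :=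
  ∃ c : ℝ, ∀ X Y : Finset Γ, 0 < setDist X Y →
    ∀ A ∈ localAlgebra (d := d) X, ∀ B ∈ localAlgebra (d := d) Y,
      ‖correlator φ A B‖ ≤
        c * ‖A‖ * ‖B‖ * min (X.card : ℝ) (Y.card : ℝ) * g (setDist X Y)

/-- For some constant `c'`, all finite `X`, `Y` with `l = d(X, Y) > 0` and all `A ∈ 𝒜_X`,
`B ∈ 𝒜_Y`: `|⟨⟨A, B⟩⟩_φ| ≤ c' ‖A‖ ‖B‖ min (|X| ^ 2, |Y| ^ 2) g'(l)`. -/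
def CanonicalCorrelatorsDecay (β : ℝ) (τ : ℝ → (Observable d ≃⋆ₐ[ℂ] Observable d))
    (φ : Observable d →L[ℂ] ℂ) (g' : ℝ → ℝ) : Prop :=
  ∃ c' : ℝ, ∀ X Y : Finset Γ, 0 < setDist X Y →
    ∀ A ∈ localAlgebra (d := d) X, ∀ B ∈ localAlgebra (d := d) Y,
      ‖canonicalCorrelator β τ φ A B‖ ≤
        c' * ‖A‖ * ‖B‖ * min ((X.card : ℝ) ^ 2) ((Y.card : ℝ) ^ 2) * g' (setDist X Y)

end Decay

end QuantumSpin

end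

/-!
Fix `A ∈ 𝒜_X`, `B ∈ 𝒜_Y` and let `G(z) = F_{A,B}(z) - φ(A) φ(B)`, a bounded holomorphic function
on the strip `0 ≤ Im z ≤ β`. A KMS state with `β > 0` is invariant under the time evolution
(`IsKMSState.apply_evolved`, from the fact that a bounded holomorphic function with equal values
on the two boundary lines is constant), so the boundary values of `G` are the ordinary correlators
`⟨A, τ_t(B)⟩` and `⟨τ_t(B), A⟩`. If these are bounded by `κ exp (v |t|)` for all real `t`, then
the maximum principle applied to `G(z) exp (-z ^ 2)` bounds `G` on the segment `[0, iβ]` by a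
constant times `κ`, the constant depending on `β` and `v` only (`norm_le_of_strip_boundary_exp`).
The canonical correlator is the average of `G` over this segment. The Gaussian absorbs exponential
growth of any rate; this is why the decay rate of the canonical correlators involves neither `β`
nor `v`.

It remains to bound `⟨τ_t(A), B⟩` and `⟨B, τ_t(A)⟩` by a multiple of `|X| ^ 2 max (g (l / 4), exp
(-μ l / 2)) exp (v |t|)`; by invariance the evolution can be moved to the observable with the
smaller support. A Lieb–Robinson bound for finite-volume evolutions
(`norm_commutator_heisenberg_le`), inserted into Duhamel's formula, shows that evolving `A` in the
`k`-neighbourhood of `X` only changes `τ_t(A)` by at most a constant times `|X| (1 + k) ^ D exp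
(-μ k) exp (v |t|)` (`IsTimeEvolution.exists_local_approx`). The decay assumption for a
neighbourhood of radius proportional to `l` would cost a power of `l`. Instead the approximation
with `k ≈ 3 l / 4` is written as a telescoping sum over `k`: the `k`-th increment lives in a
volume of order `|X| (1 + k) ^ D` at distance at least `l / 4` from `Y` and is exponentially small
in `k`, so the sum converges (`norm_le_of_local_approx`).

For `β = 0` the canonical and the ordinary correlators coincide. Polynomial and exponential decay
are special cases of the general statement.
-/

noncomputable section

namespace QuantumSpin

universe u

/-! ### Bounded holomorphic functions on a strip -/

section Strip

/-- The maximum principle on a strip for functions that are bounded and continuous up to the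
boundary. -/
lemma norm_le_of_strip_boundary {β M C : ℝ} (hβ : 0 < β) {F : ℂ → ℂ}
    (hc : ContinuousOn F {z | 0 ≤ z.im ∧ z.im ≤ β})
    (hd : DifferentiableOn ℂ F {z | 0 < z.im ∧ z.im < β})
    (hM : ∀ z : ℂ, 0 ≤ z.im → z.im ≤ β → ‖F z‖ ≤ M)
    (hlow : ∀ t : ℝ, ‖F t‖ ≤ C) (hup : ∀ t : ℝ, ‖F (t + Complex.I * β)‖ ≤ C)
    {z : ℂ} (h0 : 0 ≤ z.im) (h1 : z.im ≤ β) : ‖F z‖ ≤ C := by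
  refine PhragmenLindelof.horizontal_strip (a := 0) (b := β) (f := F) ⟨hd, ?_⟩ ?_ ?_ ?_ h0 h1
  · refine hc.mono ?_
    refine closure_minimal (fun z hz => ⟨hz.1.le, hz.2.le⟩) ?_
    exact (isClosed_le continuous_const Complex.continuous_im).inter
      (isClosed_le Complex.continuous_im continuous_const)
  · refine ⟨0, div_pos Real.pi_pos (by linarith), 0, ?_⟩
    refine Asymptotics.IsBigO.of_bound M ?_
    refine Filter.eventually_inf_principal.2 (Eventually.of_forall fun z hz => ?_)
    simpa using hM z hz.1.le hz.2.le
  · intro w hw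
    have : w = (w.re : ℂ) := by apply Complex.ext <;> simp [hw]
    rw [this]; exact hlow _
  · intro w hw
    have : w = (w.re : ℂ) + Complex.I * β := by apply Complex.ext <;> simp [hw]
    rw [this]; exact hup _

/-- A function on a strip whose boundary values grow at most exponentially is bounded on the
imaginary segment; the Gaussian `exp (-z ^ 2)` absorbs any exponential growth, so that no relation
between the growth rate `a` and the width `β` is needed. -/
lemma norm_le_of_strip_boundary_exp {β M κ a : ℝ} (hβ : 0 < β) {F : ℂ → ℂ}
    (hc : ContinuousOn F {z | 0 ≤ z.im ∧ z.im ≤ β})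
    (hd : DifferentiableOn ℂ F {z | 0 < z.im ∧ z.im < β})
    (hM : ∀ z : ℂ, 0 ≤ z.im → z.im ≤ β → ‖F z‖ ≤ M) (hκ : 0 ≤ κ)
    (hlow : ∀ t : ℝ, ‖F t‖ ≤ κ * Real.exp (a * |t|))
    (hup : ∀ t : ℝ, ‖F (t + Complex.I * β)‖ ≤ κ * Real.exp (a * |t|))
    {b : ℝ} (h0 : 0 ≤ b) (h1 : b ≤ β) :
    ‖F (Complex.I * b)‖ ≤ κ * Real.exp (a ^ 2 / 4 + β ^ 2) := by
  have hnorm : ∀ z : ℂ, ‖Complex.exp (-z ^ 2)‖ = Real.exp (z.im ^ 2 - z.re ^ 2) := by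
    intro z
    rw [Complex.norm_exp]
    congr 1
    simp [pow_two]
  have hM0 : 0 ≤ M := (norm_nonneg _).trans (hM 0 (by simp) (by simpa using hβ.le))
  have hbd : ∀ t s : ℝ, 0 ≤ s → s ≤ β → κ * Real.exp (a * |t|) * Real.exp (s ^ 2 - t ^ 2) ≤
      κ * Real.exp (a ^ 2 / 4 + β ^ 2) := by
    intro t s hs0 hs1
    rw [mul_assoc, ← Real.exp_add]
    refine mul_le_mul_of_nonneg_left (Real.exp_le_exp.2 ?_) hκ
    nlinarith [sq_nonneg (|t| - a / 2), sq_abs t]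
  have key := norm_le_of_strip_boundary (M := M * Real.exp (β ^ 2))
    (C := κ * Real.exp (a ^ 2 / 4 + β ^ 2)) hβ
    (F := fun z => F z * Complex.exp (-z ^ 2))
    (hc.mul (by fun_prop)) (hd.mul (by fun_prop)) ?_ ?_ ?_
    (z := Complex.I * b) (by simpa using h0) (by simpa using h1)
  · rw [norm_mul, hnorm] at key
    refine le_trans ?_ key
    refine le_mul_of_one_le_right (norm_nonneg _) (Real.one_le_exp ?_)
    simp [sq_nonneg]
  · intro z hz0 hz1
    rw [norm_mul, hnorm]
    refine mul_le_mul (hM z hz0 hz1) (Real.exp_le_exp.2 ?_) (Real.exp_pos _).le hM0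
    nlinarith [sq_nonneg z.re]
  · intro t
    rw [norm_mul, hnorm]
    refine le_trans ?_ (hbd t 0 le_rfl hβ.le)
    simpa using mul_le_mul_of_nonneg_right (hlow t) (Real.exp_pos (-t ^ 2)).le
  · intro t
    rw [norm_mul, hnorm]
    refine le_trans ?_ (hbd t β hβ.le le_rfl)
    simpa using mul_le_mul_of_nonneg_right (hup t) (Real.exp_pos (β ^ 2 - t ^ 2)).le

/-- A bounded holomorphic function on a strip that is real on the boundary is constant: `exp (±i G)`
have modulus one on the boundary, so they have modulus at most one inside. -/
lemma const_of_strip_boundary_real {β M : ℝ} (hβ : 0 < β) {G : ℂ → ℂ}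
    (hc : ContinuousOn G {z | 0 ≤ z.im ∧ z.im ≤ β})
    (hd : DifferentiableOn ℂ G {z | 0 < z.im ∧ z.im < β})
    (hM : ∀ z : ℂ, 0 ≤ z.im → z.im ≤ β → ‖G z‖ ≤ M)
    (hlow : ∀ t : ℝ, (G t).im = 0) (hup : ∀ t : ℝ, (G (t + Complex.I * β)).im = 0) (s t : ℝ) :
    G s = G t := by
  set U : Set ℂ := {z | 0 < z.im ∧ z.im < β} with hU
  have hUo : IsOpen U := (isOpen_lt continuous_const Complex.continuous_im).inter
      (isOpen_lt Complex.continuous_im continuous_const)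
  have hUconv : Convex ℝ U := by
    have : U = Complex.imLm ⁻¹' (Set.Ioo 0 β) := rfl
    rw [this]
    exact (convex_Ioo 0 β).linear_preimage Complex.imLm
  have him : ∀ (σ : ℝ), |σ| = 1 → ∀ z ∈ U, σ * (G z).im ≤ 0 := by
    intro σ hσ z hz
    have hn : ∀ w : ℂ, ‖Complex.exp (-(Complex.I * σ) * G w)‖ = Real.exp (σ * (G w).im) := by
      intro w
      rw [Complex.norm_exp]
      congr 1
      simp
    have := norm_le_of_strip_boundary (C := 1) (M := Real.exp M) hβ
      (F := fun w => Complex.exp (-(Complex.I * σ) * G w))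
      (Complex.continuous_exp.comp_continuousOn (continuousOn_const.mul hc))
      ((differentiableOn_const _).mul hd).cexp
      ?_ ?_ ?_ hz.1.le hz.2.le
    · rw [hn] at this
      exact Real.exp_le_one_iff.1 this
    · intro w hw0 hw1
      rw [hn]
      refine Real.exp_le_exp.2 ((le_abs_self _).trans ?_)
      rw [abs_mul, hσ, one_mul]
      exact (Complex.abs_im_le_norm _).trans (hM w hw0 hw1)
    · intro x; rw [hn, hlow]; simp
    · intro x; rw [hn, hup]; simp
  have him0 : ∀ z ∈ U, (G z).im = 0 := fun z hz =>
    le_antisymm (by simpa using him 1 (by simp) z hz) (by simpa using him (-1) (by simp) z hz)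
  have hUne : U.Nonempty := ⟨Complex.I * (β / 2 : ℝ), by constructor <;> simp <;> linarith⟩
  obtain ⟨c, hcU⟩ : ∃ c, ∀ z ∈ U, G z = c :=
    (hd.analyticOnNhd hUo).eq_const_of_im_eq_const him0 hUo ⟨hUne, hUconv.isPreconnected⟩
  have hval : ∀ x : ℝ, G x = c := by
    intro x
    -- the boundary value is the limit of the values along the vertical line above `x`
    have h1 : Tendsto (fun b : ℝ => (x : ℂ) + Complex.I * b) (𝓝[>] 0)
        (𝓝[{z | 0 ≤ z.im ∧ z.im ≤ β}] (x : ℂ)) := by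
      refine tendsto_nhdsWithin_iff.2 ⟨?_, ?_⟩
      · have : Continuous fun b : ℝ => (x : ℂ) + Complex.I * b := by fun_prop
        simpa using (this.tendsto 0).mono_left nhdsWithin_le_nhds
      · filter_upwards [Ioo_mem_nhdsGT hβ] with b hb
        simpa using ⟨hb.1.le, hb.2.le⟩
    have h2 := (hc x (by simpa using hβ.le)).tendsto.comp h1
    have h3 : Tendsto (fun b : ℝ => G ((x : ℂ) + Complex.I * b)) (𝓝[>] 0) (𝓝 c) := by
      refine tendsto_const_nhds.congr' ?_
      filter_upwards [Ioo_mem_nhdsGT hβ] with b hb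
      exact (hcU _ (by simpa [U] using hb)).symm
    exact tendsto_nhds_unique h2 h3
  rw [hval, hval]

/-- A bounded holomorphic function on a strip with equal boundary values on the two lines is
constant there. With the reflection `F' z = conj F (conj z + iβ)`, both `F + F'` and `i (F - F')`
are real on the boundary. -/
lemma const_of_strip_boundary_eq {β M : ℝ} (hβ : 0 < β) {F : ℂ → ℂ}
    (hc : ContinuousOn F {z | 0 ≤ z.im ∧ z.im ≤ β})
    (hd : DifferentiableOn ℂ F {z | 0 < z.im ∧ z.im < β})
    (hM : ∀ z : ℂ, 0 ≤ z.im → z.im ≤ β → ‖F z‖ ≤ M)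
    (heq : ∀ t : ℝ, F (t + Complex.I * β) = F t) (s t : ℝ) : F s = F t := by
  set F' : ℂ → ℂ := fun z => (starRingEnd ℂ) (F ((starRingEnd ℂ) z + Complex.I * β)) with hF'
  have hc' : ContinuousOn F' {z | 0 ≤ z.im ∧ z.im ≤ β} := by
    refine Complex.continuous_conj.comp_continuousOn (hc.comp (by fun_prop) ?_)
    intro z hz
    simp only [Set.mem_ofPred_eq] at hz
    constructor <;> simp <;> linarith
  have hd' : DifferentiableOn ℂ F' {z | 0 < z.im ∧ z.im < β} := by
    intro z hz
    have hz' : (starRingEnd ℂ) z + Complex.I * β ∈ {z : ℂ | 0 < z.im ∧ z.im < β} := by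
      simp only [Set.mem_ofPred_eq] at hz
      constructor <;> simp <;> linarith
    have hUo : IsOpen {z : ℂ | 0 < z.im ∧ z.im < β} :=
      (isOpen_lt continuous_const Complex.continuous_im).inter
        (isOpen_lt Complex.continuous_im continuous_const)
    have h1 : DifferentiableAt ℂ F ((starRingEnd ℂ) z + Complex.I * β) :=
      (hd _ hz').differentiableAt (hUo.mem_nhds hz')
    have h2 : DifferentiableAt ℂ (fun w => F (w + Complex.I * β)) ((starRingEnd ℂ) z) :=
      h1.comp ((starRingEnd ℂ) z) (by fun_prop : DifferentiableAt ℂ (fun w => w + Complex.I * β) _)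
    exact (differentiableAt_conj_conj_iff.2 h2).differentiableWithinAt
  have hM' : ∀ z : ℂ, 0 ≤ z.im → z.im ≤ β → ‖F' z‖ ≤ M := by
    intro z h0 h1
    simp only [hF', RCLike.norm_conj]
    apply hM <;> simp <;> linarith
  have hlow : ∀ x : ℝ, F' x = (starRingEnd ℂ) (F x) := by
    intro x; simp [hF', heq]
  have hup : ∀ x : ℝ, F' (x + Complex.I * β) = (starRingEnd ℂ) (F x) := by
    intro x; simp [hF']
  have e1 := const_of_strip_boundary_real (M := M + M) hβ (G := fun z => F z + F' z) (hc.add hc')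
    (hd.add hd') (fun z h0 h1 => (norm_add_le _ _).trans (add_le_add (hM z h0 h1) (hM' z h0 h1)))
    (fun x => by simp [hlow]) (fun x => by simp [hup, heq]) s t
  have e2 := const_of_strip_boundary_real (M := M + M) hβ
    (G := fun z => Complex.I * (F z - F' z))
    (continuousOn_const.mul (hc.sub hc')) ((differentiableOn_const _).mul (hd.sub hd'))
    (fun z h0 h1 => by
      rw [norm_mul, Complex.norm_I, one_mul]
      exact (norm_sub_le _ _).trans (add_le_add (hM z h0 h1) (hM' z h0 h1)))
    (fun x => by simp [hlow]) (fun x => by simp [hup, heq]) s t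
  have e3 := mul_left_cancel₀ Complex.I_ne_zero e2
  linear_combination (e1 + e3) / 2

end Strip

/-! ### Inner one-parameter groups of a `C*`-algebra -/

section Heisenberg

variable {𝔸 : Type*} [CStarAlgebra 𝔸]

/-- The unitary `exp (isH)`. -/
def propagator (H : 𝔸) (s : ℝ) : 𝔸 := NormedSpace.exp (s • (Complex.I • H))

/-- The Heisenberg evolution `exp (isH) A exp (-isH)` generated by `H`. -/
def heisenberg (H : 𝔸) (s : ℝ) (A : 𝔸) : 𝔸 := propagator H s * A * propagator H (-s)

@[simp] lemma heisenberg_zero (H A : 𝔸) : heisenberg H 0 A = A := by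
  simp [heisenberg, propagator]

lemma commute_propagator {H B : 𝔸} (h : Commute H B) (s : ℝ) : Commute (propagator H s) B :=
  Commute.exp_left ((h.smul_left Complex.I).smul_left s)

lemma propagator_mul_neg (H : 𝔸) (s : ℝ) : propagator H s * propagator H (-s) = 1 := by
  let : NormedAlgebra ℚ 𝔸 := .restrictScalars ℚ ℂ 𝔸
  rw [propagator, propagator, ← NormedSpace.exp_add_of_commute]
  · simp
  · exact ((Commute.refl (Complex.I • H)).smul_left s).smul_right (-s)

lemma star_propagator {H : 𝔸} (hH : IsSelfAdjoint H) (s : ℝ) :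
    star (propagator H s) = propagator H (-s) := by
  rw [propagator, propagator, NormedSpace.star_exp]
  simp [star_smul, hH.star_eq]

lemma propagator_mem_unitary {H : 𝔸} (hH : IsSelfAdjoint H) (s : ℝ) :
    propagator H s ∈ unitary 𝔸 := by
  rw [Unitary.mem_iff, star_propagator hH]
  refine ⟨?_, propagator_mul_neg H s⟩
  simpa using propagator_mul_neg H (-s)

lemma norm_heisenberg {H : 𝔸} (hH : IsSelfAdjoint H) (s : ℝ) (A : 𝔸) :
    ‖heisenberg H s A‖ = ‖A‖ := by
  rw [heisenberg, CStarRing.norm_mul_mem_unitary _ (propagator_mem_unitary hH _),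
    CStarRing.norm_mem_unitary_mul _ (propagator_mem_unitary hH _)]

lemma hasDerivAt_propagator (H : 𝔸) (s : ℝ) :
    HasDerivAt (propagator H) (propagator H s * (Complex.I • H)) s :=
  hasDerivAt_exp_smul_const (𝕂 := ℝ) (Complex.I • H) s

lemma hasDerivAt_propagator' (H : 𝔸) (s : ℝ) :
    HasDerivAt (propagator H) ((Complex.I • H) * propagator H s) s :=
  hasDerivAt_exp_smul_const' (𝕂 := ℝ) (Complex.I • H) s

/-- The product rule for the Heisenberg evolution of a time-dependent observable. -/
lemma hasDerivAt_heisenberg_comp (H : 𝔸) {f : ℝ → 𝔸} {f' : 𝔸} {s : ℝ} (hf : HasDerivAt f f' s) :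
    HasDerivAt (fun u => heisenberg H u (f u))
      (heisenberg H s (Complex.I • (H * f s - f s * H) + f')) s := by
  have h2 : HasDerivAt (fun u => propagator H (-u))
      (-((Complex.I • H) * propagator H (-s))) s := by
    simpa [Function.comp_def] using
      (hasDerivAt_propagator' H (-s)).scomp s (hasDerivAt_neg s)
  convert! ((hasDerivAt_propagator H s).mul hf).mul h2 using 1
  simp only [heisenberg, mul_add, add_mul, mul_sub, sub_mul, smul_sub, mul_smul_comm,
    smul_mul_assoc, mul_neg, mul_assoc, Pi.mul_apply]
  abel

lemma hasDerivAt_heisenberg (H A : 𝔸) (s : ℝ) :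
    HasDerivAt (fun u => heisenberg H u A)
      (Complex.I • (H * heisenberg H s A - heisenberg H s A * H)) s := by
  have h := hasDerivAt_heisenberg_comp H (hasDerivAt_const s A)
  convert! h using 1
  have h1 := (commute_propagator (Commute.refl H) s).eq
  have h2 := (commute_propagator (Commute.refl H) (-s)).eq
  simp only [heisenberg, add_zero, mul_sub, sub_mul, mul_smul_comm, smul_mul_assoc, mul_assoc, h2]
  rw [← mul_assoc H, ← h1]
  simp only [mul_assoc]

lemma norm_commutator_le (A B : 𝔸) : ‖A * B - B * A‖ ≤ 2 * ‖A‖ * ‖B‖ := by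
  refine (norm_sub_le _ _).trans ?_
  have h1 := norm_mul_le A B
  have h2 := norm_mul_le B A
  linarith

/-- The growth of a commutator `[A(u), B]` is controlled by the part `K + H` of the Hamiltonian `H`
that is left after removing a part `-K` commuting with `B`: in the interaction picture
`exp (iuK) A(u) exp (-iuK)` the commutator with `B` has the same norm, and only `K + H` enters its
derivative. -/
lemma norm_commutator_heisenberg_le_of_deriv {H K A B : 𝔸} (hK : IsSelfAdjoint K)
    (hKB : Commute K B) {b b' : ℝ → ℝ} (hb : ∀ u, HasDerivAt b (b' u) u)
    (h0 : ‖A * B - B * A‖ ≤ b 0) {s : ℝ} (hs : 0 ≤ s)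
    (hb' : ∀ u, 0 ≤ u →
      2 * ‖(K + H) * heisenberg H u A - heisenberg H u A * (K + H)‖ * ‖B‖ ≤ b' u) :
    ‖heisenberg H s A * B - B * heisenberg H s A‖ ≤ b s := by
  set f : ℝ → 𝔸 := fun u => heisenberg H u A with hf
  set E' : ℝ → 𝔸 := fun u =>
    heisenberg K u (Complex.I • ((K + H) * f u - f u * (K + H))) with hE'
  have hE : ∀ u, HasDerivAt (fun u => heisenberg K u (f u)) (E' u) u := by
    intro u
    convert! hasDerivAt_heisenberg_comp K (hasDerivAt_heisenberg H A u) using 1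
    simp only [hE', hf]
    rw [← smul_add]
    congr 2
    simp only [add_mul, mul_add]
    abel
  have hD : ∀ u, HasDerivAt (fun u => heisenberg K u (f u) * B - B * heisenberg K u (f u))
      (E' u * B - B * E' u) u := fun u =>
    ((hE u).mul_const B).sub ((hE u).const_mul B)
  have hDn : ∀ u, heisenberg K u (f u) * B - B * heisenberg K u (f u) =
      heisenberg K u (f u * B - B * f u) := by
    intro u
    have h1 := (commute_propagator hKB u).eq
    have h2 := (commute_propagator hKB (-u)).eq
    simp only [heisenberg, mul_sub, sub_mul, mul_assoc, h2]
    rw [← mul_assoc B, ← h1, mul_assoc]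
  have hgoal := image_norm_le_of_norm_deriv_right_le_deriv_boundary (a := 0) (b := s)
    (fun u _ => (hD u).continuousAt.continuousWithinAt)
    (fun u _ => (hD u).hasDerivWithinAt) ?_ hb ?_ (Set.right_mem_Icc.2 hs)
  · rwa [hDn, norm_heisenberg hK] at hgoal
  · simpa [hf] using h0
  · intro u hu
    refine (norm_commutator_le _ _).trans (le_trans (le_of_eq ?_) (hb' u hu.1))
    simp only [hE']
    rw [norm_heisenberg hK, norm_smul, Complex.norm_I, one_mul]

end Heisenberg

/-! ### Local observables -/

section Local

variable {Γ : Type u} {d : Γ → ℕ}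

/-- The `C*`-algebra structure of the quasi-local observables. It is only a local instance, so that
it does not take part in the elaboration of statements about states and correlators. -/
abbrev observableCStarAlgebra : CStarAlgebra (Observable d) where

attribute [local instance] observableCStarAlgebra

lemma mem_localAlgebra_iff {X : Finset Γ} {A : Observable d} :
    A ∈ localAlgebra X ↔ ∃ M : RegionMatrix d X, regionAction X M = A := Iff.rfl

lemma localAlgebra_mono [∀ x, NeZero (d x)] {X Y : Finset Γ} (h : X ⊆ Y) :
    localAlgebra (d := d) X ≤ localAlgebra Y := by
  classical
  intro A hA
  obtain ⟨M, hM⟩ := mem_localAlgebra_iff.1 hA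
  let σ₀ : Config d := fun _ => 0
  let ext' : LocalConfig d Y → LocalConfig d X → LocalConfig d Y := fun ρ η =>
    restrictTo Y (replaceOn X (replaceOn Y σ₀ ρ) η)
  let N : RegionMatrix d Y := fun ρ ζ =>
    ∑ η : LocalConfig d X, if ext' ρ η = ζ then M (fun x => ρ ⟨x, h x.2⟩) η else 0
  refine mem_localAlgebra_iff.2 ⟨N, ?_⟩
  rw [← hM]
  ext ψ σ
  change regionOperator Y N ψ σ = regionOperator X M ψ σ
  rw [regionOperator_apply, regionOperator_apply]
  simp only [N, Finset.sum_mul, ite_mul, zero_mul]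
  rw [Finset.sum_comm]
  refine Finset.sum_congr rfl fun η _ => ?_
  rw [Finset.sum_ite_eq, if_pos (Finset.mem_univ _)]
  have : replaceOn Y σ (ext' (restrictTo Y σ) η) = replaceOn X σ η := by
    funext x
    by_cases hx : x ∈ X
    · simp [replaceOn, ext', restrictTo, hx, h hx]
    · by_cases hy : x ∈ Y <;> simp [replaceOn, ext', restrictTo, hx, hy]
  rw [this]
  rfl

lemma commute_of_disjoint {X Y : Finset Γ} (h : Disjoint X Y) {A B : Observable d}
    (hA : A ∈ localAlgebra X) (hB : B ∈ localAlgebra Y) : Commute A B := by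
  classical
  obtain ⟨M, hM⟩ := mem_localAlgebra_iff.1 hA
  obtain ⟨N, hN⟩ := mem_localAlgebra_iff.1 hB
  apply Subtype.ext
  change (A : ConfigSpace d →L[ℂ] ConfigSpace d) * B = B * A
  rw [← hM, ← hN]
  have hXY : ∀ x ∈ X, x ∉ Y := fun x hx hy => Finset.disjoint_left.1 h hx hy
  have hYX : ∀ x ∈ Y, x ∉ X := fun x hy hx => Finset.disjoint_left.1 h hx hy
  have h1 : ∀ (σ : Config d) (η : LocalConfig d X), restrictTo Y (replaceOn X σ η) =
      restrictTo Y σ := by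
    intro σ η; funext x; simp [restrictTo, replaceOn, hYX x x.2]
  have h2 : ∀ (σ : Config d) (η : LocalConfig d Y), restrictTo X (replaceOn Y σ η) =
      restrictTo X σ := by
    intro σ η; funext x; simp [restrictTo, replaceOn, hXY x x.2]
  have h3 : ∀ (σ : Config d) (η : LocalConfig d X) (ζ : LocalConfig d Y),
      replaceOn Y (replaceOn X σ η) ζ = replaceOn X (replaceOn Y σ ζ) η := by
    intro σ η ζ; funext x
    by_cases hx : x ∈ X
    · simp [replaceOn, hx, hXY x hx]
    · simp [replaceOn, hx]
  ext ψ σ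
  change regionOperator X M (regionOperator Y N ψ) σ = regionOperator Y N (regionOperator X M ψ) σ
  simp only [regionOperator_apply, h1, h2, h3, Finset.mul_sum]
  rw [Finset.sum_comm]
  refine Finset.sum_congr rfl fun ζ _ => Finset.sum_congr rfl fun η _ => ?_
  ring

lemma isClosed_localAlgebra (X : Finset Γ) :
    IsClosed (localAlgebra (d := d) X : Set (Observable d)) := by
  have h := (LinearMap.range
    (regionAction (d := d) X).toAlgHom.toLinearMap).closed_of_finiteDimensional
  exact h.preimage continuous_subtype_val

lemma propagator_mem_localAlgebra {X : Finset Γ} {H : Observable d} (hH : H ∈ localAlgebra X)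
    (s : ℝ) : propagator H s ∈ localAlgebra X := by
  have hs : s • (Complex.I • H) ∈ localAlgebra X := by
    rw [show s • (Complex.I • H) = ((s : ℂ) * Complex.I) • H by
      rw [mul_smul, Complex.coe_smul]]
    exact (localAlgebra X).smul_mem hH _
  have hsum := NormedSpace.exp_series_hasSum_exp' (𝕂 := ℂ) (s • (Complex.I • H))
  refine (isClosed_localAlgebra X).mem_of_tendsto hsum (Eventually.of_forall fun F => ?_)
  exact sum_mem fun n _ => (localAlgebra X).smul_mem (pow_mem hs n) _

lemma heisenberg_mem_localAlgebra {X : Finset Γ} {H A : Observable d} (hH : H ∈ localAlgebra X)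
    (hA : A ∈ localAlgebra X) (s : ℝ) : heisenberg H s A ∈ localAlgebra X :=
  mul_mem (mul_mem (propagator_mem_localAlgebra hH s) hA) (propagator_mem_localAlgebra hH (-s))

lemma dense_isLocal [∀ x, NeZero (d x)] : Dense {A : Observable d | IsLocal A} := by
  intro C
  have hsub : ∀ {X : Finset Γ} {T : ConfigSpace d →L[ℂ] ConfigSpace d},
      T ∈ (regionAction (d := d) X).range → T ∈ quasiLocalAlgebra d := fun {X T} hT =>
    StarSubalgebra.le_topologicalClosure _
      ((le_iSup (fun X : Finset Γ => (regionAction (d := d) X).range) X) hT)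
  have hmono : Monotone fun X : Finset Γ => (regionAction (d := d) X).range := fun X Y h T hT =>
    localAlgebra_mono (d := d) h (x := ⟨T, hsub hT⟩) hT
  have hC : (C : ConfigSpace d →L[ℂ] ConfigSpace d) ∈
      closure ((⨆ X : Finset Γ, (regionAction (d := d) X).range :
        StarSubalgebra ℂ (ConfigSpace d →L[ℂ] ConfigSpace d)) : Set _) := C.2
  rw [StarSubalgebra.coe_iSup_of_directed hmono.directed_le] at hC
  refine Metric.mem_closure_iff.2 fun ε hε => ?_
  obtain ⟨T, hT, hTC⟩ := Metric.mem_closure_iff.1 hC ε hε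
  obtain ⟨X, hX⟩ := Set.mem_iUnion.1 hT
  exact ⟨⟨T, hsub hX⟩, ⟨X, hX⟩, hTC⟩

lemma norm_starAlgEquiv (α : Observable d ≃⋆ₐ[ℂ] Observable d) (A : Observable d) :
    ‖α A‖ = ‖A‖ :=
  NonUnitalStarAlgHom.norm_map α α.injective A

lemma continuous_starAlgEquiv (α : Observable d ≃⋆ₐ[ℂ] Observable d) : Continuous α :=
  (NonUnitalStarAlgHom.isometry α α.injective).continuous

end Local

/-! ### Lieb–Robinson bounds -/

section LiebRobinson

attribute [local instance] observableCStarAlgebra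

variable {Γ : Type u} {d : Γ → ℕ}

/-- The Hamiltonian `∑_{X ⊆ Λ} Φ X` of the finite volume `Λ`. -/
def Interaction.localHamiltonian (Φ : Interaction d) (Λ : Finset Γ) : Observable d :=
  ∑ X ∈ Λ.powerset, Φ.toFun X

lemma Interaction.isSelfAdjoint_sum (Φ : Interaction d) (S : Finset (Finset Γ)) :
    IsSelfAdjoint (∑ X ∈ S, Φ.toFun X) :=
  _root_.isSelfAdjoint_sum S fun X _ => Φ.isSelfAdjoint X

lemma Interaction.isSelfAdjoint_localHamiltonian (Φ : Interaction d) (Λ : Finset Γ) :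
    IsSelfAdjoint (Φ.localHamiltonian Λ) := Φ.isSelfAdjoint_sum _

lemma Interaction.localHamiltonian_mem [∀ x, NeZero (d x)] (Φ : Interaction d) (Λ : Finset Γ) :
    Φ.localHamiltonian Λ ∈ localAlgebra Λ :=
  sum_mem fun X hX => localAlgebra_mono (Finset.mem_powerset.1 hX) (Φ.mem_localAlgebra X)

lemma sum_commutator {ι : Type*} (S : Finset ι) (f : ι → Observable d) (C : Observable d) :
    (∑ W ∈ S, f W) * C - C * ∑ W ∈ S, f W = ∑ W ∈ S, (f W * C - C * f W) := by
  rw [Finset.sum_mul, Finset.mul_sum, Finset.sum_sub_distrib]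

lemma Interaction.localDerivation_eq (Φ : Interaction d) (Λ : Finset Γ) (A : Observable d) :
    Φ.localDerivation Λ A =
      Complex.I • (Φ.localHamiltonian Λ * A - A * Φ.localHamiltonian Λ) := by
  rw [localDerivation, localHamiltonian, sum_commutator]

variable [MetricSpace Γ]

lemma Interaction.IsShortRange.sum_le {Φ : Interaction d} {μ v : ℝ} (hΦ : Φ.IsShortRange μ v)
    (x : Γ) (S : Finset (Finset Γ)) (hS : ∀ W ∈ S, x ∈ W) :
    ∑ W ∈ S, ‖Φ.toFun W‖ * (W.card : ℝ) * Real.exp (μ * Metric.diam (W : Set Γ)) ≤ v / 2 := by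
  classical
  have h := (hΦ x).1.sum_le_tsum (S.subtype (fun W => x ∈ W)) (fun W _ => by positivity)
  refine le_trans (le_of_eq ?_) (h.trans (hΦ x).2)
  rw [← Finset.sum_subtype_of_mem (p := fun W : Finset Γ => x ∈ W)
    (fun W : Finset Γ => ‖Φ.toFun W‖ * (W.card : ℝ) * Real.exp (μ * Metric.diam (W : Set Γ))) hS]

/-- Summing the short-range condition over the sites of `Z`: if every `W ∈ S` meets `Z` in a site
`z` with `f W ≤ |W| exp (μ diam W) u z`, then `∑_{W ∈ S} ‖Φ W‖ f W ≤ (v / 2) ∑_{z ∈ Z} u z`. -/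
lemma Interaction.IsShortRange.sum_mul_le {Φ : Interaction d} {μ v : ℝ}
    (hΦ : Φ.IsShortRange μ v) (Z : Finset Γ) (S : Finset (Finset Γ)) (f : Finset Γ → ℝ) (u : Γ → ℝ)
    (hu : ∀ z, 0 ≤ u z)
    (hf : ∀ W ∈ S, ∃ z ∈ Z, z ∈ W ∧
      f W ≤ (W.card : ℝ) * Real.exp (μ * Metric.diam (W : Set Γ)) * u z) :
    ∑ W ∈ S, ‖Φ.toFun W‖ * f W ≤ v / 2 * ∑ z ∈ Z, u z := by
  classical
  calc ∑ W ∈ S, ‖Φ.toFun W‖ * f W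
      ≤ ∑ W ∈ S, ∑ z ∈ Z, if z ∈ W then ‖Φ.toFun W‖ * (W.card : ℝ) *
          Real.exp (μ * Metric.diam (W : Set Γ)) * u z else 0 := by
        refine Finset.sum_le_sum fun W hW => ?_
        obtain ⟨z, hz, hzW, h⟩ := hf W hW
        calc ‖Φ.toFun W‖ * f W ≤ ‖Φ.toFun W‖ *
              ((W.card : ℝ) * Real.exp (μ * Metric.diam (W : Set Γ)) * u z) := by gcongr
          _ = if z ∈ W then ‖Φ.toFun W‖ * (W.card : ℝ) *
                Real.exp (μ * Metric.diam (W : Set Γ)) * u z else 0 := by rw [if_pos hzW]; ring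
          _ ≤ _ := Finset.single_le_sum (f := fun z => if z ∈ W then ‖Φ.toFun W‖ * (W.card : ℝ) *
                Real.exp (μ * Metric.diam (W : Set Γ)) * u z else 0)
                (fun y _ => by have := hu y; positivity) hz
    _ = ∑ z ∈ Z, (∑ W ∈ S with z ∈ W, ‖Φ.toFun W‖ * (W.card : ℝ) *
          Real.exp (μ * Metric.diam (W : Set Γ))) * u z := by
        rw [Finset.sum_comm]
        refine Finset.sum_congr rfl fun z _ => ?_
        rw [Finset.sum_mul, Finset.sum_filter]
    _ ≤ ∑ z ∈ Z, v / 2 * u z := by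
        refine Finset.sum_le_sum fun z _ => mul_le_mul_of_nonneg_right ?_ (hu z)
        exact hΦ.sum_le z _ fun W hW => (Finset.mem_filter.1 hW).2
    _ = _ := by rw [Finset.mul_sum]

lemma exp_neg_infDist_le {μ : ℝ} (hμ : 0 ≤ μ) (X W : Finset Γ) {y z : Γ} (hy : y ∈ W)
    (hz : z ∈ W) : Real.exp (-(μ * Metric.infDist y (X : Set Γ))) ≤
      Real.exp (μ * Metric.diam (W : Set Γ)) * Real.exp (-(μ * Metric.infDist z (X : Set Γ))) := by
  rw [← Real.exp_add]
  refine Real.exp_le_exp.2 ?_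
  have h1 : Metric.infDist z (X : Set Γ) ≤ Metric.infDist y (X : Set Γ) + dist z y :=
    Metric.infDist_le_infDist_add_dist
  have h2 : dist z y ≤ Metric.diam (W : Set Γ) :=
    Metric.dist_le_diam_of_mem W.finite_toSet.isBounded hz hy
  nlinarith

/-- The step of the Lieb–Robinson iteration: the weights `exp (-μ d(·, X))` and `1` are reproduced
when they are summed over the interaction terms that meet `Z`. -/
lemma sum_norm_mul_weight_le {Φ : Interaction d} {μ v : ℝ} (hμ : 0 < μ) (hΦ : Φ.IsShortRange μ v)
    (X Z : Finset Γ) (S : Finset (Finset Γ)) (hS : ∀ W ∈ S, ¬ Disjoint W Z) {a e c : ℝ}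
    (ha : 0 ≤ a) (he : 0 ≤ e) (hc : 0 ≤ c) :
    ∑ W ∈ S, ‖Φ.toFun W‖ * (a * ∑ y ∈ W,
      (Real.exp (-(μ * Metric.infDist y (X : Set Γ))) * e + c)) ≤
    v / 2 * ∑ z ∈ Z, a * (Real.exp (-(μ * Metric.infDist z (X : Set Γ))) * e + c) := by
  refine hΦ.sum_mul_le Z S _ _ (fun z => by positivity) fun W hW => ?_
  obtain ⟨z, hzW, hzZ⟩ := Finset.not_disjoint_iff.1 (hS W hW)
  refine ⟨z, hzZ, hzW, ?_⟩
  have h3 : ∀ y ∈ W, Real.exp (-(μ * Metric.infDist y (X : Set Γ))) * e + c ≤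
      Real.exp (μ * Metric.diam (W : Set Γ)) *
        (Real.exp (-(μ * Metric.infDist z (X : Set Γ))) * e + c) := by
    intro y hy
    have h4 := exp_neg_infDist_le hμ.le X W hy hzW
    have h5 : 1 ≤ Real.exp (μ * Metric.diam (W : Set Γ)) :=
      Real.one_le_exp (mul_nonneg hμ.le Metric.diam_nonneg)
    rw [mul_add, ← mul_assoc]
    exact add_le_add (mul_le_mul_of_nonneg_right h4 he) (le_mul_of_one_le_left hc h5)
  have h6 := Finset.sum_le_card_nsmul W _ _ h3
  rw [nsmul_eq_mul] at h6
  calc _ ≤ a * (W.card * (Real.exp (μ * Metric.diam (W : Set Γ)) *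
        (Real.exp (-(μ * Metric.infDist z (X : Set Γ))) * e + c))) := by gcongr
    _ = _ := by ring

/-- The Lieb–Robinson bound after `n` steps of the iteration. In the interaction picture that
removes the part of the Hamiltonian disjoint from `Z`, the commutator with `B ∈ 𝒜_Z` changes only
through the terms `Φ W` with `W` meeting `Z`, to which the bound of the previous step applies. -/
lemma norm_commutator_heisenberg_le_aux [∀ x, NeZero (d x)] {Φ : Interaction d} {μ v : ℝ}
    (hμ : 0 < μ) (hv : 0 < v) (hΦ : Φ.IsShortRange μ v) {Λ X : Finset Γ} (hX : X ⊆ Λ)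
    {A : Observable d} (hA : A ∈ localAlgebra X) (n : ℕ) :
    ∀ (Z : Finset Γ) (B : Observable d), B ∈ localAlgebra Z → ∀ s : ℝ, 0 ≤ s →
      ‖heisenberg (Φ.localHamiltonian Λ) s A * B - B * heisenberg (Φ.localHamiltonian Λ) s A‖ ≤
        2 * ‖A‖ * ‖B‖ * ∑ z ∈ Z, (Real.exp (-(μ * Metric.infDist z (X : Set Γ))) *
          Real.exp (v * s) + (v * s) ^ n / n.factorial) := by
  classical
  set H := Φ.localHamiltonian Λ with hH
  have hHsa : IsSelfAdjoint H := Φ.isSelfAdjoint_localHamiltonian Λ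
  induction n with
  | zero =>
    intro Z B hB s hs
    rcases Z.eq_empty_or_nonempty with rfl | hZ
    · have hc : Commute (heisenberg H s A) B := commute_of_disjoint (X := Λ) (Y := ∅) (by simp)
        (heisenberg_mem_localAlgebra (Φ.localHamiltonian_mem Λ) (localAlgebra_mono hX hA) s) hB
      simp [hc.eq]
    · refine (norm_commutator_le _ _).trans ?_
      rw [norm_heisenberg hHsa]
      refine le_mul_of_one_le_right (by positivity) ?_
      obtain ⟨z, hz⟩ := hZ
      refine le_trans ?_ (Finset.single_le_sum (fun y _ => by positivity) hz)
      simp only [pow_zero, Nat.factorial_zero, Nat.cast_one, div_one]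
      have : 0 ≤ Real.exp (-(μ * Metric.infDist z (X : Set Γ))) * Real.exp (v * s) := by positivity
      linarith
  | succ n ih =>
    intro Z B hB s hs
    set S := Λ.powerset.filter fun W => ¬ Disjoint W Z with hS
    set K : Observable d := -∑ W ∈ Λ.powerset with Disjoint W Z, Φ.toFun W with hK
    have hKsa : IsSelfAdjoint K := (Φ.isSelfAdjoint_sum _).neg
    have hKB : Commute K B := by
      refine Commute.neg_left ?_
      exact Commute.sum_left _ _ _ fun W hW =>
        commute_of_disjoint (Finset.mem_filter.1 hW).2 (Φ.mem_localAlgebra W) hB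
    have hKH : K + H = ∑ W ∈ S, Φ.toFun W := by
      rw [hH, Interaction.localHamiltonian, hK,
        ← Finset.sum_filter_add_sum_filter_not Λ.powerset (fun W => Disjoint W Z)]
      abel
    set w : Γ → ℝ := fun z => Real.exp (-(μ * Metric.infDist z (X : Set Γ))) with hw
    have hfac : (n.factorial : ℝ) ≠ 0 := by positivity
    have hbd : ∀ x, HasDerivAt (fun s => 2 * ‖A‖ * ‖B‖ * ∑ z ∈ Z, (w z * Real.exp (v * s) +
        (v * s) ^ (n + 1) / (n + 1).factorial))
        (2 * ‖A‖ * ‖B‖ * ∑ z ∈ Z,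
          (v * (w z * Real.exp (v * x) + (v * x) ^ n / n.factorial))) x := by
      intro x
      refine HasDerivAt.const_mul _ (HasDerivAt.fun_sum fun z _ => ?_)
      have hvx : HasDerivAt (fun s => v * s) v x := by
        simpa using (hasDerivAt_id x).const_mul v
      have h1 := hvx.exp.const_mul (w z)
      have h2 := (hvx.pow (n + 1)).div_const ((n + 1).factorial : ℝ)
      convert! h1.add h2 using 1
      rw [Nat.factorial_succ, Nat.add_sub_cancel]
      push_cast
      field_simp
    refine norm_commutator_heisenberg_le_of_deriv hKsa hKB hbd ?_ hs fun u hu0 => ?_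
    · by_cases hXZ : Disjoint X Z
      · rw [(commute_of_disjoint hXZ hA hB).eq, sub_self, norm_zero]
        positivity
      · obtain ⟨z, hzX, hzZ⟩ := Finset.not_disjoint_iff.1 hXZ
        refine (norm_commutator_le _ _).trans (le_mul_of_one_le_right (by positivity) ?_)
        refine le_trans ?_ (Finset.single_le_sum (fun y _ => by positivity) hzZ)
        simp [hw, Metric.infDist_zero_of_mem (Finset.mem_coe.2 hzX)]
    · set f : Observable d := heisenberg H u A with hf
      have h1 : ‖(K + H) * f - f * (K + H)‖ ≤ ∑ W ∈ S, ‖Φ.toFun W‖ * (2 * ‖A‖ *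
          ∑ y ∈ W, (w y * Real.exp (v * u) + (v * u) ^ n / n.factorial)) := by
        rw [hKH, sum_commutator]
        refine (norm_sum_le _ _).trans (Finset.sum_le_sum fun W _ => ?_)
        rw [norm_sub_rev]
        refine (ih W _ (Φ.mem_localAlgebra W) u hu0).trans (le_of_eq ?_)
        ring
      have h2 := sum_norm_mul_weight_le hμ hΦ X Z S
        (fun W hW => (Finset.mem_filter.1 hW).2) (a := 2 * ‖A‖) (e := Real.exp (v * u))
        (c := (v * u) ^ n / n.factorial) (by positivity) (by positivity) (by positivity)
      calc 2 * ‖(K + H) * f - f * (K + H)‖ * ‖B‖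
          ≤ 2 * (v / 2 * ∑ z ∈ Z, 2 * ‖A‖ *
            (w z * Real.exp (v * u) + (v * u) ^ n / n.factorial)) * ‖B‖ := by
              gcongr; exact h1.trans h2
        _ = _ := by rw [← Finset.mul_sum, ← Finset.mul_sum]; ring

/-- The **Lieb–Robinson bound** for the evolution of a finite volume. -/
lemma norm_commutator_heisenberg_le [∀ x, NeZero (d x)] {Φ : Interaction d} {μ v : ℝ}
    (hμ : 0 < μ) (hv : 0 < v) (hΦ : Φ.IsShortRange μ v) {Λ X : Finset Γ} (hX : X ⊆ Λ)
    {A : Observable d} (hA : A ∈ localAlgebra X) {Z : Finset Γ} {B : Observable d}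
    (hB : B ∈ localAlgebra Z) {s : ℝ} (hs : 0 ≤ s) :
    ‖heisenberg (Φ.localHamiltonian Λ) s A * B - B * heisenberg (Φ.localHamiltonian Λ) s A‖ ≤
      2 * ‖A‖ * ‖B‖ * ∑ z ∈ Z, (Real.exp (-(μ * Metric.infDist z (X : Set Γ))) *
        Real.exp (v * s)) := by
  refine ge_of_tendsto' (x := atTop) (f := fun n : ℕ => 2 * ‖A‖ * ‖B‖ *
    ∑ z ∈ Z, (Real.exp (-(μ * Metric.infDist z (X : Set Γ))) *
          Real.exp (v * s) + (v * s) ^ n / n.factorial)) ?_ fun n =>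
      norm_commutator_heisenberg_le_aux hμ hv hΦ hX hA n Z B hB s hs
  refine Tendsto.const_mul _ (tendsto_finsetSum _ fun z _ => ?_)
  simpa using (FloorSemiring.tendsto_pow_div_factorial_atTop (v * s)).const_add
    (Real.exp (-(μ * Metric.infDist z (X : Set Γ))) * Real.exp (v * s))

end LiebRobinson

/-! ### Local approximation of the time evolution -/

section Approximation

attribute [local instance] observableCStarAlgebra

variable {Γ : Type u} {d : Γ → ℕ}

/-- The product rule for `u ↦ τ (-u) (C u)`, at a time at which `C` is in the domain of the
generator of `τ`. -/
lemma IsTimeEvolution.hasDerivAt_neg_comp {Φ : Interaction d}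
    {τ : ℝ → (Observable d ≃⋆ₐ[ℂ] Observable d)} (hτ : IsTimeEvolution Φ τ) {C : ℝ → Observable d}
    {C' δC : Observable d} {s : ℝ} (hC : HasDerivAt C C' s)
    (hδ : HasDerivAt (fun t => τ t (C s)) δC 0) :
    HasDerivAt (fun u => τ (-u) (C u)) (τ (-s) (C' - δC)) s := by
  have h1 : HasDerivAt (fun u => τ (-u) (C u - C s)) (τ (-s) C') s := by
    rw [hasDerivAt_iff_tendsto_slope]
    have e : slope (fun u => τ (-u) (C u - C s)) s = fun u => τ (-u) (slope C s u) := by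
      funext u
      rw [slope_def_module, slope_def_module, sub_self, _root_.map_zero, sub_zero,
        ← Complex.coe_smul, ← Complex.coe_smul, map_smul]
    rw [e]
    have hs := hasDerivAt_iff_tendsto_slope.1 hC
    have h2 : Tendsto (fun u => τ (-u) (slope C s u - C')) (𝓝[≠] s) (𝓝 0) := by
      rw [tendsto_zero_iff_norm_tendsto_zero]
      simp only [norm_starAlgEquiv]
      exact tendsto_zero_iff_norm_tendsto_zero.1 (tendsto_sub_nhds_zero_iff.2 hs)
    have h3 : Tendsto (fun u => τ (-u) C') (𝓝[≠] s) (𝓝 (τ (-s) C')) :=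
      (((hτ.continuous C').comp continuous_neg).tendsto s).mono_left nhdsWithin_le_nhds
    simpa using h2.add h3
  have h2 : HasDerivAt (fun u => τ (-u) (C s)) (-(τ (-s) δC)) s := by
    have e : (fun u => τ (-u) (C s)) = fun u => τ (-s) (τ (s - u) (C s)) := by
      funext u; rw [← hτ.map_add]; congr 2; ring
    have h3 : HasDerivAt (fun u => τ (s - u) (C s)) (-δC) s := by
      have h4 : HasDerivAt (fun t => τ t (C s)) δC (s - s) := by rwa [sub_self]
      simpa [Function.comp_def] using h4.scomp s ((hasDerivAt_id s).const_sub s)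
    rw [e]
    -- `τ (-s)` as a continuous real-linear map
    let L : Observable d →L[ℝ] Observable d :=
      LinearMap.mkContinuous
        { toFun := τ (-s)
          map_add' := fun x y => _root_.map_add _ x y
          map_smul' := fun c x => by
            simp only [RingHom.id_apply]
            rw [← Complex.coe_smul, ← Complex.coe_smul, map_smul] }
        1 (fun x => by rw [one_mul]; exact (norm_starAlgEquiv _ x).le)
    have h5 := L.hasFDerivAt.comp_hasDerivAt s h3
    have h6 : L (-δC) = -(τ (-s) δC) := map_neg (τ (-s)) δC
    rw [← h6]
    exact h5
  convert! h1.add h2 using 1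
  · funext u
    simp
  · rw [map_sub, sub_eq_add_neg]

/-- The interaction `-Φ`, which generates the reversed time evolution. -/
def Interaction.neg (Φ : Interaction d) : Interaction d where
  toFun X := -Φ.toFun X
  isSelfAdjoint X := (Φ.isSelfAdjoint X).neg
  mem_localAlgebra X := neg_mem (Φ.mem_localAlgebra X)

lemma IsTimeEvolution.neg {Φ : Interaction d}
    {τ : ℝ → (Observable d ≃⋆ₐ[ℂ] Observable d)} (hτ : IsTimeEvolution Φ τ) :
    IsTimeEvolution Φ.neg (fun t => τ (-t)) where
  map_zero A := by rw [neg_zero, hτ.map_zero]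
  map_add s t A := by rw [neg_add, hτ.map_add]
  continuous A := (hτ.continuous A).comp continuous_neg
  hasDerivAt A hA := by
    obtain ⟨δA, h1, h2⟩ := hτ.hasDerivAt A hA
    refine ⟨-δA, ?_, ?_⟩
    · refine h1.neg.congr fun Λ => ?_
      rw [Interaction.localDerivation, Interaction.localDerivation, ← smul_neg,
        ← Finset.sum_neg_distrib]
      congr 1
      refine Finset.sum_congr rfl fun X _ => ?_
      simp only [Interaction.neg, neg_mul, mul_neg]
      abel
    · have h3 : HasDerivAt (fun t => τ t A) δA (-0) := by rwa [neg_zero]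
      simpa [Function.comp_def] using h3.scomp 0 (hasDerivAt_neg 0)

variable [MetricSpace Γ]

/-- The infinite-volume derivation and that of the `r`-neighbourhood `Λ` of `X` almost agree on
observables evolved in `Λ` from `X`: only interaction terms that reach across the boundary of `Λ`
contribute. -/
lemma norm_localDerivation_sub_le [∀ x, NeZero (d x)] {Φ : Interaction d} {μ v : ℝ}
    (hμ : 0 < μ) (hv : 0 < v) (hΦ : Φ.IsShortRange μ v) {Λ X : Finset Γ} (hX : X ⊆ Λ)
    {r : ℝ} (hr : ∀ y ∉ Λ, r ≤ Metric.infDist y (X : Set Γ))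
    {A δ : Observable d} (hA : A ∈ localAlgebra X) {s : ℝ} (hs : 0 ≤ s)
    (hδ : Tendsto (fun Λ' => Φ.localDerivation Λ' (heisenberg (Φ.localHamiltonian Λ) s A)) atTop
      (𝓝 δ)) :
    ‖Φ.localDerivation Λ (heisenberg (Φ.localHamiltonian Λ) s A) - δ‖ ≤
      ‖A‖ * Λ.card * Real.exp (-(μ * r)) * (v * Real.exp (v * s)) := by
  classical
  set C := heisenberg (Φ.localHamiltonian Λ) s A with hC
  have hCmem : C ∈ localAlgebra Λ :=
    heisenberg_mem_localAlgebra (Φ.localHamiltonian_mem Λ) (localAlgebra_mono hX hA) s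
  refine le_of_tendsto (tendsto_const_nhds.sub hδ).norm ?_
  filter_upwards [eventually_ge_atTop Λ] with Λ' hΛ'
  set S := (Λ'.powerset \ Λ.powerset).filter fun W => ¬ Disjoint W Λ with hS
  have h1 : Φ.localDerivation Λ' C - Φ.localDerivation Λ C =
      Complex.I • ∑ W ∈ S, (Φ.toFun W * C - C * Φ.toFun W) := by
    rw [Interaction.localDerivation, Interaction.localDerivation, ← smul_sub,
      ← Finset.sum_sdiff (Finset.powerset_mono.2 hΛ'), add_sub_cancel_right, hS,
      Finset.sum_filter_of_ne]
    intro W _ hW hdis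
    exact hW (sub_eq_zero.2 (commute_of_disjoint hdis (Φ.mem_localAlgebra W) hCmem).eq)
  rw [norm_sub_rev, h1, norm_smul, Complex.norm_I, one_mul]
  calc ‖∑ W ∈ S, (Φ.toFun W * C - C * Φ.toFun W)‖
      ≤ ∑ W ∈ S, ‖Φ.toFun W‖ * (2 * ‖A‖ * ∑ y ∈ W,
          (Real.exp (-(μ * Metric.infDist y (X : Set Γ))) * Real.exp (v * s))) := by
        refine (norm_sum_le _ _).trans (Finset.sum_le_sum fun W _ => ?_)
        rw [norm_sub_rev]
        refine (norm_commutator_heisenberg_le hμ hv hΦ hX hA (Φ.mem_localAlgebra W) hs).trans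
          (le_of_eq ?_)
        ring
    _ ≤ v / 2 * ∑ z ∈ Λ, 2 * ‖A‖ * (Real.exp (-(μ * r)) * Real.exp (v * s)) := by
        refine hΦ.sum_mul_le Λ S _ (fun _ => 2 * ‖A‖ * (Real.exp (-(μ * r)) * Real.exp (v * s)))
          (fun z => by positivity) fun W hW => ?_
        obtain ⟨hW1, hW2⟩ := Finset.mem_filter.1 hW
        obtain ⟨z, hzW, hzΛ⟩ := Finset.not_disjoint_iff.1 hW2
        have hW3 : ¬ W ⊆ Λ := fun h => (Finset.mem_sdiff.1 hW1).2 (Finset.mem_powerset.2 h)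
        obtain ⟨x, hxW, hxΛ⟩ := Finset.not_subset.1 hW3
        refine ⟨z, hzΛ, hzW, ?_⟩
        have h3 : ∀ y ∈ W, Real.exp (-(μ * Metric.infDist y (X : Set Γ))) * Real.exp (v * s) ≤
            Real.exp (μ * Metric.diam (W : Set Γ)) * (Real.exp (-(μ * r)) * Real.exp (v * s)) := by
          intro y hy
          rw [← mul_assoc]
          refine mul_le_mul_of_nonneg_right ?_ (Real.exp_pos _).le
          refine (exp_neg_infDist_le hμ.le X W hy hxW).trans ?_
          refine mul_le_mul_of_nonneg_left (Real.exp_le_exp.2 ?_) (Real.exp_pos _).le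
          nlinarith [hr x hxΛ]
        have h6 := Finset.sum_le_card_nsmul W _ _ h3
        rw [nsmul_eq_mul] at h6
        calc _ ≤ 2 * ‖A‖ * (W.card * (Real.exp (μ * Metric.diam (W : Set Γ)) *
              (Real.exp (-(μ * r)) * Real.exp (v * s)))) := by gcongr
          _ = _ := by ring
    _ = _ := by rw [Finset.sum_const, nsmul_eq_mul]; ring

/-- Duhamel's formula in differential form: `τ (-s)` applied to the evolution of `A` in the volume `Λ`
up to time `s` changes only through the difference of the two derivations. -/
lemma IsTimeEvolution.norm_sub_heisenberg_le_of_nonneg [∀ x, NeZero (d x)] {Φ : Interaction d}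
    {τ : ℝ → (Observable d ≃⋆ₐ[ℂ] Observable d)} (hτ : IsTimeEvolution Φ τ) {μ v : ℝ}
    (hμ : 0 < μ) (hv : 0 < v) (hΦ : Φ.IsShortRange μ v) {Λ X : Finset Γ} (hX : X ⊆ Λ)
    {r : ℝ} (hr : ∀ y ∉ Λ, r ≤ Metric.infDist y (X : Set Γ))
    {A : Observable d} (hA : A ∈ localAlgebra X) {t : ℝ} (ht : 0 ≤ t) :
    ‖τ t A - heisenberg (Φ.localHamiltonian Λ) t A‖ ≤
      ‖A‖ * Λ.card * Real.exp (-(μ * r)) * Real.exp (v * t) := by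
  set H := Φ.localHamiltonian Λ with hH
  have hloc : ∀ s, IsLocal (heisenberg H s A) := fun s =>
    ⟨Λ, heisenberg_mem_localAlgebra (Φ.localHamiltonian_mem Λ) (localAlgebra_mono hX hA) s⟩
  choose δ hδ1 hδ2 using fun s => hτ.hasDerivAt _ (hloc s)
  have hder : ∀ s, HasDerivAt (fun u => τ (-u) (heisenberg H u A) - A)
      (τ (-s) (Φ.localDerivation Λ (heisenberg H s A) - δ s)) s := by
    intro s
    have h := hτ.hasDerivAt_neg_comp (hasDerivAt_heisenberg H A s) (hδ2 s)
    rw [Interaction.localDerivation_eq]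
    exact h.sub_const A
  have hbd : ∀ s, HasDerivAt (fun s => ‖A‖ * Λ.card * Real.exp (-(μ * r)) * Real.exp (v * s))
      (‖A‖ * Λ.card * Real.exp (-(μ * r)) * (v * Real.exp (v * s))) s := by
    intro s
    have hvx : HasDerivAt (fun s => v * s) v s := by simpa using (hasDerivAt_id s).const_mul v
    simpa [mul_comm] using hvx.exp.const_mul (‖A‖ * Λ.card * Real.exp (-(μ * r)))
  have key := image_norm_le_of_norm_deriv_right_le_deriv_boundary (a := 0) (b := t)
      (fun u _ => (hder u).continuousAt.continuousWithinAt)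
      (fun u _ => (hder u).hasDerivWithinAt) ?_ hbd ?_ (Set.right_mem_Icc.2 ht)
  · rw [← norm_starAlgEquiv (τ t), map_sub, ← hτ.map_add, add_neg_cancel, hτ.map_zero] at key
    rwa [norm_sub_rev]
  · simp only [neg_zero, heisenberg_zero, hτ.map_zero, sub_self, norm_zero]
    positivity
  · intro s hs
    rw [norm_starAlgEquiv]
    exact norm_localDerivation_sub_le hμ hv hΦ hX hr hA hs.1 (hδ1 s)

/-- The time evolution of `A ∈ 𝒜_X` is approximated by observables of the `r`-neighbourhood `Λ`
of `X`. -/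
lemma IsTimeEvolution.exists_local_approx [∀ x, NeZero (d x)] {Φ : Interaction d}
    {τ : ℝ → (Observable d ≃⋆ₐ[ℂ] Observable d)} (hτ : IsTimeEvolution Φ τ) {μ v : ℝ}
    (hμ : 0 < μ) (hv : 0 < v) (hΦ : Φ.IsShortRange μ v) {Λ X : Finset Γ} (hX : X ⊆ Λ)
    {r : ℝ} (hr : ∀ y ∉ Λ, r ≤ Metric.infDist y (X : Set Γ))
    {A : Observable d} (hA : A ∈ localAlgebra X) (t : ℝ) :
    ∃ A' ∈ localAlgebra (d := d) Λ, ‖A'‖ = ‖A‖ ∧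
      ‖τ t A - A'‖ ≤ ‖A‖ * Λ.card * Real.exp (-(μ * r)) * Real.exp (v * |t|) := by
  rcases le_total 0 t with ht | ht
  · refine ⟨heisenberg (Φ.localHamiltonian Λ) t A, heisenberg_mem_localAlgebra
      (Φ.localHamiltonian_mem Λ) (localAlgebra_mono hX hA) t,
      norm_heisenberg (Φ.isSelfAdjoint_localHamiltonian Λ) t A, ?_⟩
    rw [abs_of_nonneg ht]
    exact hτ.norm_sub_heisenberg_le_of_nonneg hμ hv hΦ hX hr hA ht
  · refine ⟨heisenberg (Φ.neg.localHamiltonian Λ) (-t) A, heisenberg_mem_localAlgebra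
      (Φ.neg.localHamiltonian_mem Λ) (localAlgebra_mono hX hA) _,
      norm_heisenberg (Φ.neg.isSelfAdjoint_localHamiltonian Λ) _ A, ?_⟩
    have hΦ' : Φ.neg.IsShortRange μ v := by
      intro x
      simpa [Interaction.neg] using hΦ x
    have h := hτ.neg.norm_sub_heisenberg_le_of_nonneg hμ hv hΦ' hX hr hA (neg_nonneg.2 ht)
    rw [abs_of_nonpos ht]
    simpa using h

end Approximation

/-! ### From local approximation to decay of evolved correlators -/

section Telescoping

lemma exists_rpow_le_mul_exp {p a : ℝ} (ha : 0 < a) :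
    ∃ Q : ℝ, 0 ≤ Q ∧ ∀ x : ℝ, 0 ≤ x → 0 ≤ p → x ^ p ≤ Q * Real.exp (a * x) := by
  set m := ⌈p⌉₊ with hm
  refine ⟨1 + m.factorial / a ^ m, by positivity, fun x hx hp => ?_⟩
  have h1 : 1 ≤ Real.exp (a * x) := Real.one_le_exp (by positivity)
  have h2 : x ^ m ≤ m.factorial / a ^ m * Real.exp (a * x) := by
    have := Real.pow_div_factorial_le_exp (a * x) (by positivity) m
    rw [div_le_iff₀ (by positivity), mul_pow] at this
    rw [div_mul_eq_mul_div, le_div_iff₀ (by positivity)]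
    linarith
  have h3 : 0 ≤ m.factorial / a ^ m * Real.exp (a * x) := by positivity
  rw [add_mul, one_mul]
  rcases le_total x 1 with h | h
  · have := Real.rpow_le_one hx h hp
    linarith
  · have : x ^ p ≤ x ^ (m : ℝ) := Real.rpow_le_rpow_of_exponent_le h (Nat.le_ceil p)
    rw [Real.rpow_natCast] at this
    linarith

variable {Γ : Type u}

set_option maxHeartbeats 1000000 in
/-- A functional `ψ` (in the application, the correlator with an observable of the region `Y`) that
is small on observables far from `Y` is small on `τ_t(A)`. Here `A' k` approximates `τ_t(A)` in the
`(k + 1)`-neighbourhood `Λ k` of the support of `A`; writing `A' m` as a telescoping sum, the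
volume of `Λ k` is compensated by the exponential smallness of `A' (k + 1) - A' k`. -/
lemma norm_le_of_local_approx {d : Γ → ℕ} [∀ x, NeZero (d x)] {ψ : Observable d →L[ℂ] ℂ}
    {T : Observable d} {A' : ℕ → Observable d} {Λ : ℕ → Finset Γ} {a b c C Q G N E μ p : ℝ} {m : ℕ}
    (ha : 0 ≤ a) (hb : 0 ≤ b) (hc : 0 ≤ c) (hQ : 0 ≤ Q) (hC : 0 ≤ C) (hN : 1 ≤ N) (hE : 1 ≤ E)
    (hG : 0 ≤ G) (hμ : 0 < μ) (hp : 0 < p) (hmono : Monotone Λ)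
    (hcard : ∀ k, ((Λ k).card : ℝ) ≤ C * N * (k + 2) ^ p)
    (hpQ : ∀ k : ℕ, ((k : ℝ) + 3) ^ (2 * p) ≤ Q * Real.exp (μ / 3 * k))
    (hA' : ∀ k, A' k ∈ localAlgebra (Λ k)) (hA'n : ∀ k, ‖A' k‖ = a)
    (happ : ∀ k, ‖T - A' k‖ ≤ a * (Λ k).card * Real.exp (-(μ * (k + 1))) * E)
    (hψ : ∀ B, ‖ψ B‖ ≤ 2 * b * ‖B‖)
    (hψ' : ∀ k ≤ m, ∀ B ∈ localAlgebra (d := d) (Λ k), ‖ψ B‖ ≤ c * ‖B‖ * b * (Λ k).card * G) :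
    ‖ψ T‖ ≤ (2 * C * Q * Real.exp (-(2 * μ / 3 * m)) +
      (c * C * Q + 2 * c * C ^ 2 * Q * ∑' k : ℕ, Real.exp (-(2 * μ / 3)) ^ k) * G) *
        (a * b * N ^ 2 * E) := by
  have hNN : N ≤ N ^ 2 := by nlinarith
  have hpow : ∀ k : ℕ, ((k : ℝ) + 2) ^ p ≤ Q * Real.exp (μ / 3 * k) := by
    intro k
    refine le_trans ?_ (hpQ k)
    calc ((k : ℝ) + 2) ^ p ≤ ((k : ℝ) + 3) ^ p := by gcongr; norm_num
      _ ≤ ((k : ℝ) + 3) ^ (2 * p) :=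
        Real.rpow_le_rpow_of_exponent_le (by linarith [k.cast_nonneg (α := ℝ)]) (by linarith)
  have hexp : ∀ k : ℕ, Real.exp (μ / 3 * k) * Real.exp (-(μ * (k + 1))) ≤
      Real.exp (-(2 * μ / 3 * k)) := by
    intro k
    rw [← Real.exp_add]
    refine Real.exp_le_exp.2 ?_
    linarith
  have hsq : ∀ k : ℕ, ((Λ (k + 1)).card : ℝ) ^ 2 * Real.exp (-(μ * (k + 1))) ≤
      C ^ 2 * N ^ 2 * Q * Real.exp (-(2 * μ / 3)) ^ k := by
    intro k
    have h1 : ((Λ (k + 1)).card : ℝ) ^ 2 ≤ C ^ 2 * N ^ 2 * (Q * Real.exp (μ / 3 * k)) := by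
      have h2 := hcard (k + 1)
      push_cast at h2
      rw [add_assoc, show (1 : ℝ) + 2 = 3 by norm_num] at h2
      calc ((Λ (k + 1)).card : ℝ) ^ 2 ≤ (C * N * ((k : ℝ) + 3) ^ p) ^ 2 := by gcongr
        _ = C ^ 2 * N ^ 2 * ((k : ℝ) + 3) ^ (2 * p) := by
          rw [mul_comm 2 p, Real.rpow_mul (by positivity), mul_pow, mul_pow]
          norm_cast
        _ ≤ _ := by gcongr; exact hpQ k
    have h3 : Real.exp (-(2 * μ / 3)) ^ k = Real.exp (-(2 * μ / 3 * k)) := by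
      rw [← Real.exp_nat_mul]; congr 1; ring
    rw [h3]
    calc _ ≤ C ^ 2 * N ^ 2 * (Q * Real.exp (μ / 3 * k)) * Real.exp (-(μ * (k + 1))) := by gcongr
      _ = C ^ 2 * N ^ 2 * Q * (Real.exp (μ / 3 * k) * Real.exp (-(μ * (k + 1)))) := by ring
      _ ≤ _ := by gcongr; exact hexp k
  have hrem : ‖ψ (T - A' m)‖ ≤ 2 * C * Q * Real.exp (-(2 * μ / 3 * m)) * (a * b * N ^ 2 * E) := by
    calc ‖ψ (T - A' m)‖ ≤ 2 * b * (a * (Λ m).card * Real.exp (-(μ * (m + 1))) * E) :=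
          (hψ _).trans (by gcongr; exact happ m)
      _ ≤ 2 * b * (a * (C * N * (Q * Real.exp (μ / 3 * m))) * Real.exp (-(μ * (m + 1))) * E) := by
          gcongr
          exact (hcard m).trans (by gcongr; exact hpow m)
      _ = 2 * C * Q * (Real.exp (μ / 3 * m) * Real.exp (-(μ * (m + 1)))) * (a * b * N * E) := by
          ring
      _ ≤ _ := by
          gcongr
          exact hexp m
  have hzero : ‖ψ (A' 0)‖ ≤ c * C * Q * G * (a * b * N ^ 2 * E) := by
    have h1 : ((Λ 0).card : ℝ) ≤ C * N * Q := by
      refine (hcard 0).trans ?_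
      have := hpow 0
      simp only [CharP.cast_eq_zero, mul_zero, Real.exp_zero, mul_one] at this ⊢
      gcongr
    calc ‖ψ (A' 0)‖ ≤ c * a * b * (Λ 0).card * G := by
          have := hψ' 0 (Nat.zero_le _) _ (hA' 0)
          rwa [hA'n] at this
      _ ≤ c * a * b * (C * N * Q) * G := by gcongr
      _ = c * C * Q * G * (a * b * N * 1) := by ring
      _ ≤ _ := by gcongr
  have hstep : ∀ k ∈ Finset.range m, ‖ψ (A' (k + 1)) - ψ (A' k)‖ ≤
      2 * c * C ^ 2 * Q * G * (a * b * N ^ 2 * E) * Real.exp (-(2 * μ / 3)) ^ k := by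
    intro k hk
    have hkm : k + 1 ≤ m := Finset.mem_range.1 hk
    have hmem : A' (k + 1) - A' k ∈ localAlgebra (Λ (k + 1)) :=
      sub_mem (hA' _) (localAlgebra_mono (hmono (Nat.le_succ k)) (hA' k))
    have hle : ((Λ k).card : ℝ) ≤ (Λ (k + 1)).card := by
      exact_mod_cast Finset.card_le_card (hmono (Nat.le_succ k))
    have hnorm : ‖A' (k + 1) - A' k‖ ≤
        2 * (a * (Λ (k + 1)).card * Real.exp (-(μ * (k + 1))) * E) := by
      have h1 : ‖T - A' k‖ ≤ a * (Λ (k + 1)).card * Real.exp (-(μ * (k + 1))) * E :=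
        (happ k).trans (by gcongr)
      have h2 : ‖T - A' (k + 1)‖ ≤ a * (Λ (k + 1)).card * Real.exp (-(μ * (k + 1))) * E := by
        refine (happ (k + 1)).trans ?_
        gcongr
        linarith
      have h3 : A' (k + 1) - A' k = (T - A' k) - (T - A' (k + 1)) := by abel
      rw [h3]
      exact (norm_sub_le _ _).trans (by linarith)
    rw [← map_sub]
    calc _ ≤ c * ‖A' (k + 1) - A' k‖ * b * (Λ (k + 1)).card * G := hψ' _ hkm _ hmem
      _ ≤ c * (2 * (a * (Λ (k + 1)).card * Real.exp (-(μ * (k + 1))) * E)) * b *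
          (Λ (k + 1)).card * G := by gcongr
      _ = 2 * c * G * (a * b * E) *
          (((Λ (k + 1)).card : ℝ) ^ 2 * Real.exp (-(μ * (k + 1)))) := by ring
      _ ≤ 2 * c * G * (a * b * E) * (C ^ 2 * N ^ 2 * Q * Real.exp (-(2 * μ / 3)) ^ k) := by
          refine mul_le_mul_of_nonneg_left (hsq k) (by positivity)
      _ = _ := by ring
  have hsum : Summable fun k : ℕ => Real.exp (-(2 * μ / 3)) ^ k :=
    summable_geometric_of_lt_one (Real.exp_pos _).le (Real.exp_lt_one_iff.2 (by linarith))
  have htel : ‖ψ (A' m) - ψ (A' 0)‖ ≤ 2 * c * C ^ 2 * Q * G * (a * b * N ^ 2 * E) *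
      ∑' k : ℕ, Real.exp (-(2 * μ / 3)) ^ k := by
    rw [← Finset.sum_range_sub (fun k => ψ (A' k)) m]
    refine (norm_sum_le _ _).trans ((Finset.sum_le_sum hstep).trans ?_)
    rw [← Finset.mul_sum]
    gcongr
    exact hsum.sum_le_tsum _ fun k _ => by positivity
  have hsplit : ψ T = ψ (T - A' m) + (ψ (A' m) - ψ (A' 0)) + ψ (A' 0) := by
    rw [map_sub]; ring
  rw [hsplit]
  refine (norm_add₃_le).trans ?_
  calc _ ≤ _ := add_le_add (add_le_add hrem htel) hzero
    _ = _ := by ring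

variable [MetricSpace Γ]

lemma setDist_comm (X Y : Finset Γ) : setDist X Y = setDist Y X := by
  unfold setDist
  rw [← (Equiv.prodComm Y X).iInf_comp]
  simp [dist_comm]

lemma nonempty_left_of_setDist_pos {X Y : Finset Γ} (h : 0 < setDist X Y) : X.Nonempty := by
  by_contra hX
  rw [Finset.not_nonempty_iff_eq_empty] at hX
  subst hX
  simp [setDist, Real.iInf_of_isEmpty] at h

lemma nonempty_right_of_setDist_pos {X Y : Finset Γ} (h : 0 < setDist X Y) : Y.Nonempty :=
  nonempty_left_of_setDist_pos (setDist_comm X Y ▸ h)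

lemma setDist_le_dist {X Y : Finset Γ} {x y : Γ} (hx : x ∈ X) (hy : y ∈ Y) :
    setDist X Y ≤ dist x y :=
  ciInf_le (f := fun p : X × Y => dist (p.1 : Γ) (p.2 : Γ))
    ⟨0, by rintro _ ⟨p, rfl⟩; exact dist_nonneg⟩ (⟨x, hx⟩, ⟨y, hy⟩)

lemma sub_le_setDist_of_subset_thickening {X Y Λ : Finset Γ} {r : ℝ} (hΛ : Λ.Nonempty)
    (hY : Y.Nonempty) (h : ∀ y ∈ Λ, y ∈ Metric.thickening r (X : Set Γ)) :
    setDist X Y - r ≤ setDist Λ Y := by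
  have := hΛ.to_subtype
  have := hY.to_subtype
  refine le_ciInf fun p => ?_
  obtain ⟨x, hx, hxp⟩ := Metric.mem_thickening_iff.1 (h p.1 p.1.2)
  have h1 := setDist_le_dist (Finset.mem_coe.1 hx) p.2.2
  have h2 := dist_triangle_left x (p.2 : Γ) (p.1 : Γ)
  linarith

set_option maxHeartbeats 1000000 in
/-- Correlators of time-evolved observables decay in space, uniformly up to the factor
`exp (v |t|)`. -/
lemma exists_evolved_decay (hΓ : HasPolynomialGrowth Γ) {d : Γ → ℕ} [∀ x, NeZero (d x)]
    {Φ : Interaction d} {μ v : ℝ} (hμ : 0 < μ) (hv : 0 < v) (hΦ : Φ.IsShortRange μ v)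
    {τ : ℝ → (Observable d ≃⋆ₐ[ℂ] Observable d)} (hτ : IsTimeEvolution Φ τ)
    {g : ℝ → ℝ} (hg : AntitoneOn g (Set.Ioi 0)) (hg0 : ∀ l, 0 < l → 0 ≤ g l) {c : ℝ} (hc : 0 ≤ c) :
    ∃ K : ℝ, 0 ≤ K ∧ ∀ X Y : Finset Γ, 0 < setDist X Y → ∀ A ∈ localAlgebra (d := d) X,
      ∀ (t b : ℝ) (ψ : Observable d →L[ℂ] ℂ), 0 ≤ b → (∀ B, ‖ψ B‖ ≤ 2 * b * ‖B‖) →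
        (∀ X' : Finset Γ, 0 < setDist X' Y → ∀ B ∈ localAlgebra (d := d) X',
          ‖ψ B‖ ≤ c * ‖B‖ * b * X'.card * g (setDist X' Y)) →
        ‖ψ (τ t A)‖ ≤ K * (‖A‖ * b * (X.card : ℝ) ^ 2) *
          max (g (setDist X Y / 4)) (Real.exp (-(μ * setDist X Y / 2))) * Real.exp (v * |t|) := by
  obtain ⟨C, hC, p, hp, hgrowth⟩ := hΓ
  obtain ⟨Q₀, hQ₀, hQ₀'⟩ := exists_rpow_le_mul_exp (p := 2 * p) (a := μ / 3) (by positivity)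
  set Q := Q₀ * Real.exp μ with hQ
  have hpQ : ∀ k : ℕ, ((k : ℝ) + 3) ^ (2 * p) ≤ Q * Real.exp (μ / 3 * k) := by
    intro k
    refine (hQ₀' _ (by positivity) (by positivity)).trans (le_of_eq ?_)
    rw [hQ, mul_assoc, ← Real.exp_add]
    congr 2
    ring
  set S := ∑' k : ℕ, Real.exp (-(2 * μ / 3)) ^ k with hS
  have hS0 : 0 ≤ S := tsum_nonneg fun k => by positivity
  have hQ0 : 0 ≤ Q := by positivity
  refine ⟨2 * Real.exp (2 * μ) + (2 * C * Q * Real.exp (4 * μ / 3) +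
    (c * C * Q + 2 * c * C ^ 2 * Q * S)), by positivity, ?_⟩
  intro X Y hl A hA t b ψ hb hψ hψ'
  set l := setDist X Y with hl'
  have hXne := nonempty_left_of_setDist_pos hl
  have hYne := nonempty_right_of_setDist_pos hl
  have hN : (1 : ℝ) ≤ X.card := by exact_mod_cast hXne.card_pos
  have hE : 1 ≤ Real.exp (v * |t|) := Real.one_le_exp (by positivity)
  set R := max (g (l / 4)) (Real.exp (-(μ * l / 2))) with hR
  have hR0 : 0 ≤ R := (Real.exp_pos _).le.trans (le_max_right _ _)
  set P := ‖A‖ * b * (X.card : ℝ) ^ 2 * Real.exp (v * |t|) with hP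
  have hP0 : 0 ≤ P := by positivity
  suffices h : ‖ψ (τ t A)‖ ≤ 2 * Real.exp (2 * μ) * R * P ∨
      ‖ψ (τ t A)‖ ≤ (2 * C * Q * Real.exp (4 * μ / 3) +
        (c * C * Q + 2 * c * C ^ 2 * Q * S)) * R * P by
    have e : ∀ k : ℝ, k * (‖A‖ * b * (X.card : ℝ) ^ 2) * R * Real.exp (v * |t|) = k * R * P := by
      intro k; rw [hP]; ring
    rw [e, add_mul, add_mul]
    have h1 : 0 ≤ 2 * Real.exp (2 * μ) * R * P := by positivity
    have h2 : 0 ≤ (2 * C * Q * Real.exp (4 * μ / 3) +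
        (c * C * Q + 2 * c * C ^ 2 * Q * S)) * R * P := by positivity
    rcases h with h | h <;> linarith
  rcases lt_or_ge l 4 with hl4 | hl4
  · left
    have h1 : 1 ≤ Real.exp (2 * μ) * R := by
      calc (1 : ℝ) ≤ Real.exp (2 * μ) * Real.exp (-(μ * l / 2)) := by
            rw [← Real.exp_add]; exact Real.one_le_exp (by nlinarith)
        _ ≤ _ := by gcongr; exact le_max_right _ _
    calc ‖ψ (τ t A)‖ ≤ 2 * b * ‖A‖ := by rw [← norm_starAlgEquiv (τ t) A]; exact hψ _
      _ = 2 * 1 * (‖A‖ * b * 1 ^ 2 * 1) := by ring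
      _ ≤ 2 * (Real.exp (2 * μ) * R) * P := by rw [hP]; gcongr
      _ = _ := by ring
  · right
    have hfin : ∀ k : ℕ, (Metric.thickening ((k : ℝ) + 1) (X : Set Γ)).Finite := fun k =>
      (hgrowth X _ (by positivity)).1
    set Λ : ℕ → Finset Γ := fun k => (hfin k).toFinset with hΛ
    have hmem : ∀ k y, y ∈ Λ k ↔ y ∈ Metric.thickening ((k : ℝ) + 1) (X : Set Γ) := fun k y =>
      (hfin k).mem_toFinset
    have hXΛ : ∀ k, X ⊆ Λ k := fun k x hx =>
      (hmem k x).2 (Metric.self_subset_thickening (show (0 : ℝ) < k + 1 by positivity) _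
        (Finset.mem_coe.2 hx))
    have hmono : Monotone Λ := by
      intro k k' hk x hx
      refine (hmem k' x).2 (Metric.thickening_mono ?_ _ ((hmem k x).1 hx))
      have : (k : ℝ) ≤ k' := by exact_mod_cast hk
      linarith
    have hcard : ∀ k, ((Λ k).card : ℝ) ≤ C * X.card * (k + 2) ^ p := by
      intro k
      have h := (hgrowth X ((k : ℝ) + 1) (by positivity)).2
      rw [Set.ncard_eq_toFinset_card _ (hfin k)] at h
      refine h.trans (le_of_eq ?_)
      congr 2
      ring
    have hr : ∀ k, ∀ y ∉ Λ k, (k : ℝ) + 1 ≤ Metric.infDist y (X : Set Γ) := by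
      intro k y hy
      by_contra hlt
      exact hy ((hmem k y).2
        ((Metric.mem_thickening_iff_infDist_lt (Finset.coe_nonempty.2 hXne)).2 (not_le.1 hlt)))
    choose A' hA'1 hA'2 hA'3 using fun k =>
      hτ.exists_local_approx hμ hv hΦ (hXΛ k) (hr k) hA t
    set m : ℕ := ⌊3 * l / 4⌋₊ - 1 with hm
    have hfl : 1 ≤ ⌊3 * l / 4⌋₊ := Nat.le_floor (by push_cast; linarith)
    have hm1 : (m : ℝ) + 1 = ⌊3 * l / 4⌋₊ := by
      rw [hm, Nat.cast_sub hfl, Nat.cast_one, sub_add_cancel]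
    have hm2 : (m : ℝ) + 1 ≤ 3 * l / 4 := by
      rw [hm1]; exact Nat.floor_le (by linarith)
    have hm3 : 3 * l / 4 < (m : ℝ) + 2 := by
      have := Nat.lt_floor_add_one (3 * l / 4)
      rw [← hm1] at this
      linarith
    have key := norm_le_of_local_approx (norm_nonneg A) hb hc hQ0 hC.le hN hE
      (hg0 (l / 4) (by linarith)) hμ hp hmono hcard hpQ hA'1 hA'2 hA'3 hψ (m := m) ?_
    · refine key.trans ?_
      rw [← hS, ← hP]
      refine mul_le_mul_of_nonneg_right ?_ hP0
      rw [add_mul _ _ R]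
      have hgR : (c * C * Q + 2 * c * C ^ 2 * Q * S) * g (l / 4) ≤
          (c * C * Q + 2 * c * C ^ 2 * Q * S) * R :=
        mul_le_mul_of_nonneg_left (le_max_left _ _) (by positivity)
      refine add_le_add ?_ hgR
      rw [mul_assoc (2 * C * Q)]
      refine mul_le_mul_of_nonneg_left ?_ (by positivity)
      calc Real.exp (-(2 * μ / 3 * m)) ≤ Real.exp (4 * μ / 3) * Real.exp (-(μ * l / 2)) := by
            rw [← Real.exp_add]; exact Real.exp_le_exp.2 (by nlinarith)
        _ ≤ _ := by gcongr; exact le_max_right _ _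
    · intro k hk B hB
      have hk' : (k : ℝ) ≤ m := by exact_mod_cast hk
      have h1 := sub_le_setDist_of_subset_thickening (hXne.mono (hXΛ k)) hYne
        fun y hy => (hmem k y).1 hy
      have h2 : l / 4 ≤ setDist (Λ k) Y := by linarith
      have h3 : 0 < setDist (Λ k) Y := by linarith
      have h4 : g (setDist (Λ k) Y) ≤ g (l / 4) :=
        hg (Set.mem_Ioi.2 (by linarith)) (Set.mem_Ioi.2 h3) h2
      have h5 : 0 ≤ c * ‖B‖ * b * (Λ k).card :=
        mul_nonneg (mul_nonneg (mul_nonneg hc (norm_nonneg B)) hb) (Nat.cast_nonneg _)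
      exact (hψ' _ h3 B hB).trans (mul_le_mul_of_nonneg_left h4 h5)

end Telescoping

/-! ### KMS states and canonical correlators -/

section KMS

variable {Γ : Type u} {d : Γ → ℕ} {β : ℝ} {τ : ℝ → (Observable d ≃⋆ₐ[ℂ] Observable d)}
  {φ : Observable d →L[ℂ] ℂ}

lemma IsState.norm_apply_le (hφ : IsState φ) (A : Observable d) : ‖φ A‖ ≤ ‖A‖ := by
  have := φ.le_opNorm A
  rwa [hφ.norm_eq_one, one_mul] at this

/-- A KMS state of positive inverse temperature is invariant under the time evolution: for local
`A`, the function `F_{1, A}` takes the same values on both boundary lines of the strip. -/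
lemma IsKMSState.apply_evolved [∀ x, NeZero (d x)] (hφ : IsKMSState β τ φ) (hβ : 0 < β)
    (hτ0 : ∀ A, τ 0 A = A) (t : ℝ) (A : Observable d) : φ (τ t A) = φ A := by
  refine congrFun (Continuous.ext_on dense_isLocal
    (φ.continuous.comp (continuous_starAlgEquiv (τ t))) φ.continuous ?_) A
  intro B hB
  obtain ⟨F, hF⟩ := hφ.exists_kmsFunction 1 B ⟨∅, one_mem _⟩ hB
  obtain ⟨M, hM⟩ := hF.bounded
  have h := const_of_strip_boundary_eq hβ hF.continuousOn hF.differentiableOn hM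
    (fun t => by rw [hF.upper, hF.lower, mul_one, one_mul]) t 0
  rwa [hF.lower, hF.lower, one_mul, one_mul, hτ0] at h

lemma IsKMSState.isKMSFunction (hφ : IsKMSState β τ φ) {A B : Observable d} (hA : IsLocal A)
    (hB : IsLocal B) : IsKMSFunction β τ φ A B (kmsFunction β τ φ A B) := by
  have h := hφ.exists_kmsFunction A B hA hB
  rw [kmsFunction, dif_pos h]
  exact h.choose_spec

lemma IsKMSState.canonicalCorrelator_zero (hφ : IsKMSState 0 τ φ) (hτ0 : ∀ A, τ 0 A = A)
    {A B : Observable d} (hA : IsLocal A) (hB : IsLocal B) :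
    canonicalCorrelator 0 τ φ A B = correlator φ A B := by
  have h := (hφ.isKMSFunction hA hB).lower 0
  rw [Complex.ofReal_zero, hτ0] at h
  rw [canonicalCorrelator, if_pos rfl, h, correlator]

/-- Exponentially growing bounds in real time on the correlators with `τ_t(B)`, in both orders,
bound the canonical correlator. -/
lemma IsKMSState.norm_canonicalCorrelator_le [∀ x, NeZero (d x)] (hφ : IsKMSState β τ φ)
    (hβ : 0 < β) (hτ0 : ∀ A, τ 0 A = A) {A B : Observable d} (hA : IsLocal A) (hB : IsLocal B)
    {κ v : ℝ}
    (hκ : 0 ≤ κ) (h1 : ∀ t, ‖correlator φ A (τ t B)‖ ≤ κ * Real.exp (v * |t|))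
    (h2 : ∀ t, ‖correlator φ (τ t B) A‖ ≤ κ * Real.exp (v * |t|)) :
    ‖canonicalCorrelator β τ φ A B‖ ≤ κ * Real.exp (v ^ 2 / 4 + β ^ 2) := by
  have hF := hφ.isKMSFunction hA hB
  set F := kmsFunction β τ φ A B with hFdef
  obtain ⟨M, hM⟩ := hF.bounded
  have hbound : ∀ b : ℝ, 0 ≤ b → b ≤ β →
      ‖F (Complex.I * b) - φ A * φ B‖ ≤ κ * Real.exp (v ^ 2 / 4 + β ^ 2) := by
    intro b hb0 hb1
    refine norm_le_of_strip_boundary_exp (F := fun z => F z - φ A * φ B) (a := v)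
      (M := M + ‖φ A * φ B‖) hβ
      (hF.continuousOn.sub continuousOn_const) (hF.differentiableOn.sub (differentiableOn_const _))
      (fun z h0 h1 => (norm_sub_le _ _).trans (add_le_add (hM z h0 h1) le_rfl)) hκ
      (fun t => ?_) (fun t => ?_) hb0 hb1
    · have h := h1 t
      rwa [correlator, hφ.apply_evolved hβ hτ0, ← hF.lower] at h
    · have h := h2 t
      rwa [correlator, hφ.apply_evolved hβ hτ0, ← hF.upper, mul_comm (φ B)] at h
  have hcont : ContinuousOn (fun b : ℝ => F (Complex.I * b)) (Set.uIcc 0 β) := by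
    refine hF.continuousOn.comp (by fun_prop) fun b hb => ?_
    rw [Set.uIcc_of_le hβ.le] at hb
    simpa using hb
  have hβ' : (β : ℂ) ≠ 0 := by exact_mod_cast hβ.ne'
  have hint : canonicalCorrelator β τ φ A B =
      (1 / (β : ℂ)) * ∫ b in (0 : ℝ)..β, (F (Complex.I * b) - φ A * φ B) := by
    rw [canonicalCorrelator, if_neg hβ.ne', ← hFdef,
      intervalIntegral.integral_sub hcont.intervalIntegrable (by simp),
      intervalIntegral.integral_const, sub_zero, Complex.real_smul]
    field_simp
  rw [hint, norm_mul]
  have h3 := intervalIntegral.norm_integral_le_of_norm_le_const (a := (0 : ℝ)) (b := β)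
    (f := fun b : ℝ => F (Complex.I * b) - φ A * φ B)
    (C := κ * Real.exp (v ^ 2 / 4 + β ^ 2)) fun b hb => by
      rw [Set.uIoc_of_le hβ.le] at hb
      exact hbound b hb.1.le hb.2
  rw [sub_zero, abs_of_pos hβ] at h3
  rw [norm_div, norm_one, Complex.norm_real, Real.norm_of_nonneg hβ.le]
  calc _ ≤ 1 / β * (κ * Real.exp (v ^ 2 / 4 + β ^ 2) * β) := by gcongr
    _ = _ := by field_simp

/-- The functional `A ↦ ⟨A, B⟩_φ`. -/
def correlatorLeft (φ : Observable d →L[ℂ] ℂ) (B : Observable d) : Observable d →L[ℂ] ℂ :=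
  φ.comp ((ContinuousLinearMap.mul ℂ (Observable d)).flip B) - φ B • φ

/-- The functional `A ↦ ⟨B, A⟩_φ`. -/
def correlatorRight (φ : Observable d →L[ℂ] ℂ) (B : Observable d) : Observable d →L[ℂ] ℂ :=
  φ.comp (ContinuousLinearMap.mul ℂ (Observable d) B) - φ B • φ

lemma correlatorLeft_apply (φ : Observable d →L[ℂ] ℂ) (A B : Observable d) :
    correlatorLeft φ B A = correlator φ A B := by
  change φ (A * B) - φ B * φ A = φ (A * B) - φ A * φ B
  rw [mul_comm (φ B)]

lemma correlatorRight_apply (φ : Observable d →L[ℂ] ℂ) (A B : Observable d) :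
    correlatorRight φ B A = correlator φ B A := rfl

lemma IsState.norm_correlator_le (hφ : IsState φ) (A B : Observable d) :
    ‖correlator φ A B‖ ≤ 2 * ‖A‖ * ‖B‖ := by
  have h1 : ‖φ (A * B)‖ ≤ ‖A‖ * ‖B‖ := (hφ.norm_apply_le _).trans (norm_mul_le _ _)
  have h2 : ‖φ A * φ B‖ ≤ ‖A‖ * ‖B‖ := by
    rw [norm_mul]
    exact mul_le_mul (hφ.norm_apply_le _) (hφ.norm_apply_le _) (norm_nonneg _) (norm_nonneg _)
  refine (norm_sub_le (φ (A * B)) (φ A * φ B)).trans ?_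
  linarith

/-- Moving the time evolution from one observable to the other. -/
lemma correlator_evolved (hτ0 : ∀ A, τ 0 A = A) (hτadd : ∀ s t A, τ (s + t) A = τ s (τ t A))
    (hinv : ∀ t A, φ (τ t A) = φ A) (A B : Observable d) (t : ℝ) :
    correlator φ A (τ t B) = correlator φ (τ (-t) A) B ∧
      correlator φ (τ t B) A = correlator φ B (τ (-t) A) := by
  have h : ∀ C, τ (-t) (τ t C) = C := fun C => by rw [← hτadd, neg_add_cancel, hτ0]
  constructor
  · rw [correlator, correlator, hinv, hinv, ← hinv (-t) (A * _), map_mul, h]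
  · rw [correlator, correlator, hinv, hinv, ← hinv (-t) (_ * A), map_mul, h]

variable [MetricSpace Γ]

lemma mul_min_le_of_abs {c a b x y z w g : ℝ} (ha : 0 ≤ a) (hb : 0 ≤ b) (hx : 0 ≤ x) (hy : 0 ≤ y)
    (hg : 0 ≤ g) (hz : min x y ≤ z) (hw : g ≤ w) :
    c * a * b * min x y * g ≤ |c| * a * b * z * w := by
  have := le_min hx hy
  have := this.trans hz
  gcongr
  exact le_abs_self c

/-- The correlators of `τ_t(A)` with `B`, in both orders, decay in the distance of the supports. -/
lemma IsState.exists_correlator_evolved_le (hφ : IsState φ) (hΓ : HasPolynomialGrowth Γ)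
    [∀ x, NeZero (d x)] {Φ : Interaction d} {μ v : ℝ} (hμ : 0 < μ) (hv : 0 < v)
    (hΦ : Φ.IsShortRange μ v) (hτ : IsTimeEvolution Φ τ) {g : ℝ → ℝ}
    (hg : AntitoneOn g (Set.Ioi 0)) (hg0 : ∀ l, 0 < l → 0 ≤ g l) (hdecay : CorrelatorsDecay φ g) :
    ∃ K : ℝ, 0 ≤ K ∧ ∀ X Y : Finset Γ, 0 < setDist X Y → ∀ A ∈ localAlgebra (d := d) X,
      ∀ B ∈ localAlgebra (d := d) Y, ∀ t : ℝ,
        ‖correlator φ (τ t A) B‖ ≤ K * (‖A‖ * ‖B‖ * (X.card : ℝ) ^ 2) *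
          max (g (setDist X Y / 4)) (Real.exp (-(μ * setDist X Y / 2))) * Real.exp (v * |t|) ∧
        ‖correlator φ B (τ t A)‖ ≤ K * (‖A‖ * ‖B‖ * (X.card : ℝ) ^ 2) *
          max (g (setDist X Y / 4)) (Real.exp (-(μ * setDist X Y / 2))) * Real.exp (v * |t|) := by
  obtain ⟨c, hc⟩ := hdecay
  obtain ⟨K, hK0, hK⟩ := exists_evolved_decay hΓ hμ hv hΦ hτ hg hg0 (abs_nonneg c)
  refine ⟨K, hK0, fun X Y hl A hA B hB t => ⟨?_, ?_⟩⟩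
  · rw [← correlatorLeft_apply]
    refine hK X Y hl A hA t ‖B‖ (correlatorLeft φ B) (norm_nonneg B) (fun C => ?_)
      fun X' hX' C hC => ?_
    · rw [correlatorLeft_apply]
      exact (hφ.norm_correlator_le C B).trans (le_of_eq (by ring))
    · rw [correlatorLeft_apply]
      exact (hc X' Y hX' C hC B hB).trans (mul_min_le_of_abs (norm_nonneg _) (norm_nonneg _)
        (Nat.cast_nonneg _) (Nat.cast_nonneg _) (hg0 _ hX') (min_le_left _ _) le_rfl |>.trans
          (le_of_eq (by ring)))
  · rw [← correlatorRight_apply]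
    refine hK X Y hl A hA t ‖B‖ (correlatorRight φ B) (norm_nonneg B) (fun C => ?_)
      fun X' hX' C hC => ?_
    · rw [correlatorRight_apply]
      exact hφ.norm_correlator_le B C
    · rw [correlatorRight_apply]
      have h := hc Y X' (setDist_comm X' Y ▸ hX') B hB C hC
      rw [setDist_comm Y X'] at h
      exact h.trans (mul_min_le_of_abs (norm_nonneg _) (norm_nonneg _)
        (Nat.cast_nonneg _) (Nat.cast_nonneg _) (hg0 _ hX') (min_le_right _ _) le_rfl |>.trans
          (le_of_eq (by ring)))

/-- Decay of the canonical correlators at a rate that depends neither on the temperature nor on the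
velocity `v`. -/
lemma IsKMSState.canonicalCorrelatorsDecay (hφ : IsKMSState β τ φ) (hβ : 0 ≤ β)
    (hΓ : HasPolynomialGrowth Γ) [∀ x, NeZero (d x)] {Φ : Interaction d} {μ v : ℝ} (hμ : 0 < μ)
    (hv : 0 < v) (hΦ : Φ.IsShortRange μ v) (hτ : IsTimeEvolution Φ τ) {g : ℝ → ℝ}
    (hg : AntitoneOn g (Set.Ioi 0)) (hg0 : ∀ l, 0 < l → 0 ≤ g l) (hdecay : CorrelatorsDecay φ g) :
    CanonicalCorrelatorsDecay β τ φ (fun l => max (g (l / 4)) (Real.exp (-(μ * l / 2)))) := by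
  rcases hβ.eq_or_lt with rfl | hβ
  · obtain ⟨c, hc⟩ := hdecay
    refine ⟨|c|, fun X Y hl A hA B hB => ?_⟩
    rw [hφ.canonicalCorrelator_zero hτ.map_zero ⟨X, hA⟩ ⟨Y, hB⟩]
    have h1 : g (setDist X Y) ≤
        max (g (setDist X Y / 4)) (Real.exp (-(μ * setDist X Y / 2))) :=
      le_max_of_le_left (hg (Set.mem_Ioi.2 (by linarith)) (Set.mem_Ioi.2 hl) (by linarith))
    have h2 : ∀ Z : Finset Γ, (Z.card : ℝ) ≤ (Z.card : ℝ) ^ 2 := fun Z => by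
      exact_mod_cast Nat.le_self_pow two_ne_zero _
    exact (hc X Y hl A hA B hB).trans (mul_min_le_of_abs (norm_nonneg _) (norm_nonneg _)
      (Nat.cast_nonneg _) (Nat.cast_nonneg _) (hg0 _ hl) (min_le_min (h2 X) (h2 Y)) h1)
  · obtain ⟨K, hK0, hK⟩ :=
      hφ.toIsState.exists_correlator_evolved_le hΓ hμ hv hΦ hτ hg hg0 hdecay
    refine ⟨K * Real.exp (v ^ 2 / 4 + β ^ 2), fun X Y hl A hA B hB => ?_⟩
    have hYX := fun t => hK Y X (setDist_comm X Y ▸ hl) B hB A hA t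
    have hXY := fun t => hK X Y hl A hA B hB (-t)
    simp only [setDist_comm Y X] at hYX
    set R := max (g (setDist X Y / 4)) (Real.exp (-(μ * setDist X Y / 2))) with hR
    have hR0 : 0 ≤ R := (Real.exp_pos _).le.trans (le_max_right _ _)
    have hmove := correlator_evolved hτ.map_zero hτ.map_add
      (hφ.apply_evolved hβ hτ.map_zero) A B
    have hfin := hφ.norm_canonicalCorrelator_le hβ hτ.map_zero ⟨X, hA⟩ ⟨Y, hB⟩ (v := v)
      (κ := K * (‖A‖ * ‖B‖ * min ((X.card : ℝ) ^ 2) ((Y.card : ℝ) ^ 2)) * R)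
      (mul_nonneg (mul_nonneg hK0 (mul_nonneg (mul_nonneg (norm_nonneg _) (norm_nonneg _))
        (le_min (sq_nonneg _) (sq_nonneg _)))) hR0) ?_ ?_
    · exact hfin.trans (le_of_eq (by ring))
    -- the evolution acts on the observable with the smaller support
    · intro t
      rcases le_total ((X.card : ℝ) ^ 2) ((Y.card : ℝ) ^ 2) with h | h
      · rw [min_eq_left h, (hmove t).1, ← abs_neg t]
        exact (hXY t).1
      · rw [min_eq_right h, mul_comm ‖A‖]
        exact (hYX t).2
    · intro t
      rcases le_total ((X.card : ℝ) ^ 2) ((Y.card : ℝ) ^ 2) with h | h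
      · rw [min_eq_left h, (hmove t).2, ← abs_neg t]
        exact (hXY t).2
      · rw [min_eq_right h, mul_comm ‖A‖]
        exact (hYX t).1

lemma CanonicalCorrelatorsDecay.mono {g₁ g₂ : ℝ → ℝ} (h : CanonicalCorrelatorsDecay β τ φ g₁)
    {K : ℝ} (h0 : ∀ l, 0 < l → 0 ≤ g₁ l) (hle : ∀ l, 0 < l → g₁ l ≤ K * g₂ l) :
    CanonicalCorrelatorsDecay β τ φ g₂ := by
  obtain ⟨c, hc⟩ := h
  refine ⟨|c| * K, fun X Y hl A hA B hB => ?_⟩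
  refine (hc X Y hl A hA B hB).trans ((mul_min_le_of_abs (norm_nonneg _) (norm_nonneg _)
    (sq_nonneg _) (sq_nonneg _) (h0 _ hl) le_rfl (hle _ hl)).trans (le_of_eq (by ring)))

end KMS

end QuantumSpin

end

open QuantumSpin in
theorem mainTheorem1 {Γ : Type*} [MetricSpace Γ] [DiscreteTopology Γ] [Infinite Γ]
    (hΓ : HasPolynomialGrowth Γ) (d : Γ → ℕ) [∀ x, NeZero (d x)]
    (Φ : Interaction d) (μ v : ℝ) (hμ : 0 < μ) (hv : 0 < v) (hΦ : Φ.IsShortRange μ v)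
    (τ : ℝ → (Observable d ≃⋆ₐ[ℂ] Observable d)) (hτ : IsTimeEvolution Φ τ)
    (β : ℝ) (hβ : 0 ≤ β) (φ : Observable d →L[ℂ] ℂ) (hφ : IsKMSState β τ φ) :
    (∀ g : ℝ → ℝ, AntitoneOn g (Set.Ioi 0) → (∀ l, 0 < l → 0 ≤ g l) →
      CorrelatorsDecay φ g →
      CanonicalCorrelatorsDecay β τ φ (fun l => max (g (l / 4)) (Real.exp (-(μ * l / 2))))) ∧
    (∀ n : ℝ, 0 < n → CorrelatorsDecay φ (fun l => l ^ (-n)) →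
      CanonicalCorrelatorsDecay β τ φ (fun l => l ^ (-n))) ∧
    (∀ ξ : ℝ, 0 < ξ → CorrelatorsDecay φ (fun l => Real.exp (-(l / ξ))) →
      ∃ ξ' : ℝ, 0 < ξ' ∧ CanonicalCorrelatorsDecay β τ φ (fun l => Real.exp (-(l / ξ')))) := by
  have main : ∀ g : ℝ → ℝ, AntitoneOn g (Set.Ioi 0) → (∀ l, 0 < l → 0 ≤ g l) →
      CorrelatorsDecay φ g →
      CanonicalCorrelatorsDecay β τ φ (fun l => max (g (l / 4)) (Real.exp (-(μ * l / 2)))) :=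
    fun g hg hg0 hdecay => hφ.canonicalCorrelatorsDecay hβ hΓ hμ hv hΦ hτ hg hg0 hdecay
  refine ⟨main, fun n hn hdecay => ?_, fun ξ hξ hdecay => ?_⟩
  · obtain ⟨Q, hQ0, hQ⟩ := exists_rpow_le_mul_exp (p := n) (a := μ / 2) (by positivity)
    refine (main _ (fun a ha b _ hab => ?_) (fun l hl => by positivity) hdecay).mono
      (K := max (4 ^ n) Q) (fun l _ => le_max_of_le_right (Real.exp_pos _).le) fun l hl => ?_
    · exact Real.rpow_le_rpow_of_nonpos ha hab (by linarith)
    · refine max_le ?_ ?_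
      · have : (l / 4) ^ (-n) = 4 ^ n * l ^ (-n) := by
          rw [Real.div_rpow hl.le (by norm_num), Real.rpow_neg (by norm_num : (0 : ℝ) ≤ 4),
            div_inv_eq_mul, mul_comm]
        simp only [this]
        gcongr
        exact le_max_left _ _
      · have h1 : Real.exp (-(μ * l / 2)) ≤ Q * l ^ (-n) := by
          rw [Real.rpow_neg hl.le, Real.exp_neg, ← div_eq_mul_inv, le_div_iff₀ (by positivity),
            inv_mul_le_iff₀ (Real.exp_pos _), mul_comm _ Q]
          exact (hQ l hl.le hn.le).trans (le_of_eq (by ring_nf))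
        refine h1.trans ?_
        gcongr
        exact le_max_right _ _
  · refine ⟨max (4 * ξ) (2 / μ), by positivity,
      (main _ (fun a _ b _ hab => ?_) (fun l _ => (Real.exp_pos _).le) hdecay).mono
        (K := 1) (fun l _ => le_max_of_le_right (Real.exp_pos _).le) fun l hl => ?_⟩
    · exact Real.exp_le_exp.2 (neg_le_neg (by gcongr))
    · rw [one_mul]
      refine max_le (Real.exp_le_exp.2 (neg_le_neg ?_)) (Real.exp_le_exp.2 (neg_le_neg ?_))
      · rw [div_div]
        gcongr
        exact le_max_left _ _
      · rw [show μ * l / 2 = l / (2 / μ) by field_simp]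
        gcongr
        exact le_max_right _ _
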